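/- Let $T>0$ and consider the Riccati equation \[ x' = a_2(t)x^2 + a_1(t)x + a_0(t), \qquad (R) \] where $a_0,a_1,a_2:\mathbb R\to\mathbb R$ are smooth ($C^\infty$) and $T$-periodic, and $a_2(t)\neq 0$ for all $t\in\mathbb R$. Define the $T$-periodic function \[ \gamma(t) = a_2(t)a_0(t) - A(t)^2 + A'(t), \qquad A(t)=\frac12\Big(a_1(t)+\frac{a_2'(t)}{a_2(t)}\Big), \] and put $\overline\gamma=\frac1T\int_0^T\gamma(t)\,dt$, $\widehat\gamma=\gamma-\overline\gamma$. Let $\mathcal C^1_T$ be the set of $T$-periodic $C^1$ functions $\mathbb R\to\mathbb R$, and $\mathcal C^1_{T,0}$ the subset of those with zero average. For $p\in\mathcal C^1_T$ and $q\in\mathcal C^1_{T,0}$ let \[ \underline\mu(p) = -\max_{t\in[0,T]}\big\{p(t)^2+\widehat\gamma(t)-p'(t)\big\}, \qquad \overline\mu(q) = \frac{\int_0^T e^{-2\int_0^t q(s)\,ds}\,\big(q(t)^2-\widehat\gamma(t)\big)\,dt}{\int_0^T e^{-2\int_0^t q(s)\,ds}\,dt}. \] Then $\gamma^*:=\max_{p\in\mathcal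 C^1_T}\underline\mu(p)$ and $\min_{q\in\mathcal C^1_{T,0}}\overline\mu(q)$ exist and are equal. Define the discriminant $\Delta_\gamma:=\gamma^*-\overline\gamma$. A limit cycle of (R) is an isolated $T$-periodic solution $\phi$. It is hyperbolic if $\phi(0)$ is a simple zero, and double if $\phi(0)$ is a zero of multiplicity two, of the displacement map $x_0\mapsto x(T;x_0)-x_0$, where $x(\cdot\,;x_0)$ is the solution of (R) with $x(0;x_0)=x_0$. It is semi-stable if it is asymptotically stable from one side and asymptotically stable in backward time from the other side. Then: 1. if $\Delta_\gamma>0$, equation (R) has exactly two $T$-periodic solutions, and both are hyperbolic limit cycles; 2. if $\Delta_\gamma=0$, equation (R) has exactly one $T$-periodic solution, and it is a semi-stable double limit cycle; 3. if $\Delta_\gamma<0$, equation (R) has no $T$-periodic solutions. Moreover, for all $p\in\mathcal C^1_T$ and $q\in\mathcal C^1_{T,0}$, \[ \underline\mu(p)-\overline\gamma \;\le\; \Delta_\gamma \;\le\; \overline\mu(q)-\overline\gamma . \] -/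

import Mathlib

open scoped ContDiff Topology

noncomputable section

namespace PeriodicRiccati

/-! ### Scalar equations `x' = f(t, x)` and their limit cycles -/

/-- `u` solves `x' = f(t, x)` on the set (interval) `s`. -/
def IsSolutionOn (f : ℝ → ℝ → ℝ) (s : Set ℝ) (u : ℝ → ℝ) : Prop :=
  ∀ t ∈ s, HasDerivWithinAt u (f t (u t)) s t

/-- `φ` is a `T`-periodic solution of `x' = f(t, x)`, defined on the whole line. -/
def IsPeriodicSolution (f : ℝ → ℝ → ℝ) (T : ℝ) (φ : ℝ → ℝ) : Prop :=
  IsSolutionOn f Set.univ φ ∧ Function.Periodic φ T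

/-- A limit cycle: an isolated `T`-periodic solution. -/
def IsLimitCycle (f : ℝ → ℝ → ℝ) (T : ℝ) (φ : ℝ → ℝ) : Prop :=
  IsPeriodicSolution f T φ ∧
    ∃ ε > 0, ∀ ψ, IsPeriodicSolution f T ψ → |ψ 0 - φ 0| < ε → ψ = φ

/-- The initial conditions at time `0` whose solution is defined up to time `T`. -/
def poincareDomain (f : ℝ → ℝ → ℝ) (T : ℝ) : Set ℝ :=
  {x | ∃ u, IsSolutionOn f (Set.Icc 0 T) u ∧ u 0 = x}

open Classical in
/-- The Poincaré map at time `T`: it sends `x ∈ poincareDomain f T` to the value at time `T` of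
the solution (unique when `f` is locally Lipschitz in `x`) that starts at `x` at time `0`.
Outside the domain the value is irrelevant and set to `0`. -/
def poincareMap (f : ℝ → ℝ → ℝ) (T x : ℝ) : ℝ :=
  if h : ∃ u, IsSolutionOn f (Set.Icc 0 T) u ∧ u 0 = x then h.choose T else 0

/-- The displacement map: the Poincaré map minus the identity. -/
def displacement (f : ℝ → ℝ → ℝ) (T x : ℝ) : ℝ := poincareMap f T x - x

/-- `x` is a zero of multiplicity exactly `n` of the displacement map, which has to be defined
and of class `C^n` around `x`. -/
def IsZeroOfMultiplicity (f : ℝ → ℝ → ℝ) (T : ℝ) (n : ℕ) (x : ℝ) : Prop :=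
  poincareDomain f T ∈ 𝓝 x ∧ ContDiffAt ℝ n (displacement f T) x ∧
    (∀ k < n, iteratedDeriv k (displacement f T) x = 0) ∧
    iteratedDeriv n (displacement f T) x ≠ 0

/-- A hyperbolic limit cycle: the corresponding zero of the displacement map is simple. -/
def IsHyperbolicLimitCycle (f : ℝ → ℝ → ℝ) (T : ℝ) (φ : ℝ → ℝ) : Prop :=
  IsLimitCycle f T φ ∧ IsZeroOfMultiplicity f T 1 (φ 0)

/-- A double limit cycle: the corresponding zero of the displacement map has multiplicity two. -/
def IsDoubleLimitCycle (f : ℝ → ℝ → ℝ) (T : ℝ) (φ : ℝ → ℝ) : Prop :=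
  IsLimitCycle f T φ ∧ IsZeroOfMultiplicity f T 2 (φ 0)

/-- The solution `φ` is asymptotically stable (in forward time) from above if `σ = 1`, and from
below if `σ = -1`. -/
def AttractsFromSide (f : ℝ → ℝ → ℝ) (σ : ℝ) (φ : ℝ → ℝ) : Prop :=
  ∀ ε > 0, ∃ δ > 0, ∀ x, 0 < σ * (x - φ 0) → σ * (x - φ 0) < δ →
    ∃ u, IsSolutionOn f (Set.Ici 0) u ∧ u 0 = x ∧ (∀ t, 0 ≤ t → |u t - φ t| < ε) ∧
      Filter.Tendsto (fun t => u t - φ t) Filter.atTop (𝓝 0)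

/-- The solution `φ` is asymptotically stable in backward time from above if `σ = 1`, and from
below if `σ = -1`. -/
def RepelsFromSide (f : ℝ → ℝ → ℝ) (σ : ℝ) (φ : ℝ → ℝ) : Prop :=
  ∀ ε > 0, ∃ δ > 0, ∀ x, 0 < σ * (x - φ 0) → σ * (x - φ 0) < δ →
    ∃ u, IsSolutionOn f (Set.Iic 0) u ∧ u 0 = x ∧ (∀ t, t ≤ 0 → |u t - φ t| < ε) ∧
      Filter.Tendsto (fun t => u t - φ t) Filter.atBot (𝓝 0)

/-- Semi-stability: `φ` attracts from one side and repels from the other. -/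
def IsSemiStable (f : ℝ → ℝ → ℝ) (φ : ℝ → ℝ) : Prop :=
  (AttractsFromSide f 1 φ ∧ RepelsFromSide f (-1) φ) ∨
    (AttractsFromSide f (-1) φ ∧ RepelsFromSide f 1 φ)

/-! ### The discriminant of `x' = x ^ 2 + γ(t)` -/

/-- The average of a `T`-periodic function. -/
def average (T : ℝ) (γ : ℝ → ℝ) : ℝ := 1 / T * ∫ t in (0 : ℝ)..T, γ t

/-- The mean-centered function of `γ`. -/
def centered (T : ℝ) (γ : ℝ → ℝ) (t : ℝ) : ℝ := γ t - average T γ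

/-- The `T`-periodic functions of class `C^1`. -/
def C1T (T : ℝ) : Set (ℝ → ℝ) := {p | ContDiff ℝ 1 p ∧ Function.Periodic p T}

/-- The `T`-periodic functions of class `C^1` with zero average. -/
def C1T0 (T : ℝ) : Set (ℝ → ℝ) := {p | p ∈ C1T T ∧ average T p = 0}

/-- The lower functional `-max_{t ∈ [0, T]} (p(t)^2 + γ̂(t) - p'(t))`. -/
def muLower (T : ℝ) (γ p : ℝ → ℝ) : ℝ :=
  -sSup ((fun t => p t ^ 2 + centered T γ t - deriv p t) '' Set.Icc 0 T)

/-- The weight `exp (-2 ∫_0^t p)`. -/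
def weight (p : ℝ → ℝ) (t : ℝ) : ℝ := Real.exp (-2 * ∫ s in (0 : ℝ)..t, p s)

/-- The upper functional: the mean of `p^2 - γ̂` over `[0, T]` with weight `exp (-2 ∫_0^t p)`. -/
def muUpper (T : ℝ) (γ p : ℝ → ℝ) : ℝ :=
  (∫ t in (0 : ℝ)..T, weight p t)⁻¹ *
    ∫ t in (0 : ℝ)..T, weight p t * (p t ^ 2 - centered T γ t)

/-- The number `γ^*`, the maximum of the lower functional over all `C^1` periodic functions. -/
def gammaStar (T : ℝ) (γ : ℝ → ℝ) : ℝ := sSup (muLower T γ '' C1T T)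

/-- The discriminant `Δ_γ = γ^* - average of γ`. -/
def discriminant (T : ℝ) (γ : ℝ → ℝ) : ℝ := gammaStar T γ - average T γ

/-! ### General Riccati equations -/

/-- The right-hand side `a₂(t) x^2 + a₁(t) x + a₀(t)`. -/
def riccati (a₂ a₁ a₀ : ℝ → ℝ) (t x : ℝ) : ℝ := a₂ t * x ^ 2 + a₁ t * x + a₀ t

/-- `A = (a₁ + a₂' / a₂) / 2`. -/
def shift (a₂ a₁ : ℝ → ℝ) (t : ℝ) : ℝ := 1 / 2 * (a₁ t + deriv a₂ t / a₂ t)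

/-- `γ = a₂ a₀ - A^2 + A'`. -/
def reducedGamma (a₂ a₁ a₀ : ℝ → ℝ) (t : ℝ) : ℝ :=
  a₂ t * a₀ t - shift a₂ a₁ t ^ 2 + deriv (shift a₂ a₁) t

end PeriodicRiccati

end

/-!
The substitution `y = a₂ x + A` turns (R) into `y' = y ^ 2 + γ`. In the family
`y' = y ^ 2 + γ̂ + lam`, a periodic strict upper solution yields a periodic solution between it
and a large constant. The parameters `lam` that admit a periodic solution are bounded above, since
`y'` vanishes somewhere, and by compactness there is a largest one. There the periodic solution
`y` has zero mean: otherwise the Möbius period map, which has multiplier `exp (2 ∫ y)` at `y`,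
would have a second fixed point, and the midpoint of the two solutions would be a strict upper
solution for some larger parameter. Taking `p = y` or `q = y` attains both extremal problems, and
`muLower p ≤ muUpper q` follows by integrating the derivative of `p * weight q`. The multiplier of
the period map also decides between simple and double fixed points.
-/

noncomputable section

namespace PeriodicRiccati

open Set Filter Topology

/-! ### Periodic functions -/

section Periodic

variable {k : ℝ → ℝ} {T : ℝ}

theorem periodic_deriv (hp : Function.Periodic k T) : Function.Periodic (deriv k) T := fun t => by
  rw [← deriv_comp_add_const, hp.funext]

theorem eq_of_periodic_of_eqOn {α : Type*} {u v : ℝ → α} (hT : 0 < T) (hu : Function.Periodic u T)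
    (hv : Function.Periodic v T) (h : EqOn u v (Ico 0 T)) : u = v := by
  have huv : Function.Periodic (fun t => (u t, v t)) T := fun t => by simp only [hu t, hv t]
  funext t
  obtain ⟨s, hs, hts⟩ := huv.exists_mem_Ico₀ hT t
  obtain ⟨hus, hvs⟩ := Prod.ext_iff.1 hts
  exact hus.trans ((h hs).trans hvs.symm)

theorem exists_forall_abs_le_of_periodic (hT : T ≠ 0) (hk : Continuous k)
    (hp : Function.Periodic k T) : ∃ B, ∀ t, |k t| ≤ B := by
  obtain ⟨B, hB⟩ := (hp.isBounded_of_continuous hT hk).exists_norm_le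
  exact ⟨B, fun t => hB _ (mem_range_self t)⟩

theorem exists_pos_forall_le_of_periodic (hT : T ≠ 0) (hk : Continuous k)
    (hp : Function.Periodic k T) (hpos : ∀ t, 0 < k t) : ∃ b > 0, ∀ t, b ≤ k t := by
  obtain ⟨_, ⟨s, rfl⟩, hs⟩ :=
    (hp.compact_of_continuous hT hk).exists_isLeast (range_nonempty k)
  exact ⟨k s, hpos s, fun t => hs (mem_range_self t)⟩

theorem periodic_primitive (hk : Continuous k) (hp : Function.Periodic k T)
    (h0 : ∫ s in (0 : ℝ)..T, k s = 0) :
    Function.Periodic (fun t => ∫ s in (0 : ℝ)..t, k s) T := fun t => by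
  have hshift := hp.intervalIntegral_add_eq t 0
  rw [zero_add, h0] at hshift
  beta_reduce
  rw [← intervalIntegral.integral_add_adjacent_intervals (hk.intervalIntegrable 0 t)
    (hk.intervalIntegrable t (t + T)), hshift, add_zero]

theorem forall_pos_or_forall_neg (hk : Continuous k) (hne : ∀ t, k t ≠ 0) :
    (∀ t, 0 < k t) ∨ ∀ t, k t < 0 := by
  by_contra! h
  obtain ⟨⟨s, hs⟩, ⟨t, ht⟩⟩ := h
  obtain ⟨r, hr⟩ := mem_range_of_exists_le_of_exists_ge hk ⟨s, hs⟩ ⟨t, ht⟩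
  exact hne r hr

theorem integral_deriv_eq_zero (hk : ContDiff ℝ 1 k) (hp : Function.Periodic k T) :
    ∫ t in (0 : ℝ)..T, deriv k t = 0 := by
  rw [intervalIntegral.integral_deriv_eq_sub (fun t _ => hk.differentiable one_ne_zero t)
    ((hk.continuous_deriv le_rfl).intervalIntegrable 0 T), hp.eq, sub_self]

theorem integral_logDeriv_eq_zero (hk : ContDiff ℝ 1 k) (hp : Function.Periodic k T)
    (hne : ∀ t, k t ≠ 0) : ∫ t in (0 : ℝ)..T, deriv k t / k t = 0 := by
  have hlog : deriv (fun t => Real.log (k t)) = fun t => deriv k t / k t :=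
    funext fun t => deriv.log (hk.differentiable one_ne_zero t) (hne t)
  rw [← hlog]
  exact integral_deriv_eq_zero (hk.log hne) fun t => by rw [hp t]

end Periodic

theorem hasDerivAt_primitive {k : ℝ → ℝ} (hk : Continuous k) (t : ℝ) :
    HasDerivAt (fun t => ∫ s in (0 : ℝ)..t, k s) (k t) t :=
  (hk.integral_hasStrictDerivAt 0 t).hasDerivAt

theorem average_eq_zero_iff {T : ℝ} (hT : T ≠ 0) (k : ℝ → ℝ) :
    average T k = 0 ↔ ∫ t in (0 : ℝ)..T, k t = 0 := by
  simp [average, hT]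

/-! ### Periodic solutions of scalar equations -/

section Scalar

variable {f : ℝ → ℝ → ℝ} {T : ℝ} {φ u : ℝ → ℝ} {s : Set ℝ}

theorem IsSolutionOn.continuousOn (hu : IsSolutionOn f s u) : ContinuousOn u s :=
  fun t ht => (hu t ht).continuousWithinAt

theorem IsSolutionOn.mono {s' : Set ℝ} (hu : IsSolutionOn f s u) (hs : s' ⊆ s) :
    IsSolutionOn f s' u :=
  fun t ht => (hu t (hs ht)).mono hs

theorem IsSolutionOn.hasDerivAt (hu : IsSolutionOn f univ u) (t : ℝ) :
    HasDerivAt u (f t (u t)) t :=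
  (hu t (mem_univ t)).hasDerivAt univ_mem

theorem IsSolutionOn.continuous (hu : IsSolutionOn f univ u) : Continuous u :=
  continuousOn_univ.1 hu.continuousOn

theorem IsSolutionOn.hasDerivWithinAt_Ici (hu : IsSolutionOn f (Icc 0 T) u) :
    ∀ t ∈ Ico 0 T, HasDerivWithinAt u (f t (u t)) (Ici t) t :=
  fun t ht => (hu t (Ico_subset_Icc_self ht)).mono_of_mem_nhdsWithin (Icc_mem_nhdsGE_of_mem ht)

theorem exists_continuous_periodic_eqOn (hT : 0 < T) (hu : ContinuousOn u (Icc 0 T))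
    (h0 : u 0 = u T) :
    ∃ v, Continuous v ∧ Function.Periodic v T ∧ EqOn v u (Icc 0 T) := by
  have : Fact (0 < T) := ⟨hT⟩
  have hper : Function.Periodic (fun t : ℝ => AddCircle.liftIco T 0 u (t : AddCircle T)) T :=
    fun t => by simp
  have hIco : ∀ t ∈ Ico 0 T, AddCircle.liftIco T 0 u (t : AddCircle T) = u t :=
    fun t ht => AddCircle.liftIco_zero_coe_apply ht
  refine ⟨_, (AddCircle.liftIco_zero_continuous h0 hu).comp (AddCircle.continuous_mk' T), hper,
    fun t ht => ?_⟩
  rcases ht.2.lt_or_eq with hlt | rfl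
  · exact hIco t ⟨ht.1, hlt⟩
  · exact hper.eq.trans ((hIco 0 ⟨le_rfl, hT⟩).trans h0)

theorem exists_isPeriodicSolution_eqOn (hT : 0 < T) (hf : Continuous (Function.uncurry f))
    (hp : Function.Periodic f T) (hu : IsSolutionOn f (Icc 0 T) u) (h0 : u 0 = u T) :
    ∃ φ, IsPeriodicSolution f T φ ∧ EqOn φ u (Icc 0 T) := by
  obtain ⟨v, hv, hvp, hvu⟩ := exists_continuous_periodic_eqOn hT hu.continuousOn h0
  have hk : Continuous fun t => f t (v t) := hf.comp (continuous_id.prodMk hv)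
  have hkp : Function.Periodic (fun t => f t (v t)) T := fun t => by simp only [hvp t, hp t]
  have hint : ∀ t ∈ Icc 0 T, ∫ s in (0 : ℝ)..t, f s (v s) = u t - u 0 := fun t ht => by
    refine intervalIntegral.integral_eq_sub_of_hasDerivAt_of_le ht.1
      (hu.continuousOn.mono (Icc_subset_Icc_right ht.2)) (fun s hs => ?_)
      (hk.intervalIntegrable _ _)
    have hs' : s ∈ Ioo 0 T := ⟨hs.1, hs.2.trans_le ht.2⟩
    rw [hvu (Ioo_subset_Icc_self hs')]
    exact (hu s (Ioo_subset_Icc_self hs')).hasDerivAt (Icc_mem_nhds hs'.1 hs'.2)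
  have hprim := periodic_primitive hk hkp (by rw [hint T ⟨hT.le, le_rfl⟩, h0, sub_self])
  have hv_eq : v = fun t => u 0 + ∫ s in (0 : ℝ)..t, f s (v s) :=
    eq_of_periodic_of_eqOn hT hvp (fun t => congrArg (u 0 + ·) (hprim t)) fun t ht => by
      rw [hint t (Ico_subset_Icc_self ht), hvu (Ico_subset_Icc_self ht), add_sub_cancel]
  refine ⟨v, ⟨fun t _ => ?_, hvp⟩, hvu⟩
  have hderiv := (hasDerivAt_primitive hk t).const_add (u 0)
  rw [← hv_eq] at hderiv
  exact hderiv.hasDerivWithinAt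

theorem exists_isSolutionOn_of_mem_poincareDomain {a : ℝ} (ha : a ∈ poincareDomain f T) :
    ∃ u, IsSolutionOn f (Icc 0 T) u ∧ u 0 = a ∧ u T = poincareMap f T a :=
  have ha' : ∃ u, IsSolutionOn f (Icc 0 T) u ∧ u 0 = a := ha
  ⟨_, ha'.choose_spec.1, ha'.choose_spec.2, by rw [poincareMap, dif_pos ha']⟩

theorem poincareMap_eq_of_unique (hu : IsSolutionOn f (Icc 0 T) u)
    (huniq : ∀ v, IsSolutionOn f (Icc 0 T) v → v 0 = u 0 → v T = u T) :
    poincareMap f T (u 0) = u T := by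
  obtain ⟨v, hv, hv0, hvT⟩ := exists_isSolutionOn_of_mem_poincareDomain ⟨u, hu, rfl⟩
  rw [← hvT, huniq v hv hv0]

theorem mem_poincareDomain_of_lipschitzWith_of_bounded {K : NNReal} {L : ℝ} (hT : 0 ≤ T)
    (hf : ∀ y, Continuous fun t => f t y) (hK : ∀ t, LipschitzWith K (f t))
    (hL : ∀ t y, |f t y| ≤ L) (a : ℝ) : a ∈ poincareDomain f T := by
  have hL0 : 0 ≤ L := (abs_nonneg _).trans (hL 0 0)
  have hPL : IsPicardLindelof f (tmin := 0) (tmax := T) ⟨0, le_rfl, hT⟩ a (L * T).toNNReal 0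
      L.toNNReal K :=
    { lipschitzOnWith := fun t _ => (hK t).lipschitzOnWith
      continuousOn := fun y _ => (hf y).continuousOn
      norm_le := fun t _ y _ => by
        rw [Real.coe_toNNReal _ hL0]
        exact hL t y
      mul_max_le := by
        rw [Real.coe_toNNReal _ hL0, Real.coe_toNNReal _ (by positivity)]
        simp [hT] }
  obtain ⟨u, hu0, hu⟩ := hPL.exists_eq_forall_mem_Icc_hasDerivWithinAt₀
  exact ⟨u, hu, hu0⟩

theorem abs_sub_le_gronwallBound {f₁ f₂ : ℝ → ℝ → ℝ} {u v : ℝ → ℝ} {K : NNReal} {ε : ℝ}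
    (hT : 0 ≤ T) (hK : ∀ t, LipschitzWith K (f₁ t)) (hε : ∀ t y, |f₂ t y - f₁ t y| ≤ ε)
    (hu : IsSolutionOn f₁ (Icc 0 T) u) (hv : IsSolutionOn f₂ (Icc 0 T) v) :
    |u T - v T| ≤ gronwallBound |u 0 - v 0| K ε T := by
  have hdist := dist_le_of_approx_trajectories_ODE hK hu.continuousOn hu.hasDerivWithinAt_Ici
    (εf := 0) (fun t _ => (dist_self _).le) hv.continuousOn hv.hasDerivWithinAt_Ici
    (fun t _ => hε t (v t)) le_rfl T ⟨hT, le_rfl⟩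
  simpa only [zero_add, sub_zero, Real.dist_eq] using hdist

theorem continuous_gronwallBound (K x : ℝ) :
    Continuous fun q : ℝ × ℝ => gronwallBound q.1 K q.2 x := by
  unfold gronwallBound
  split_ifs <;> fun_prop

theorem continuous_poincareMap_of_param {F : ℝ → ℝ → ℝ → ℝ} {K : NNReal} (hT : 0 ≤ T)
    (hK : ∀ lam t, LipschitzWith K (F lam t))
    (hlam : ∀ lam mu t y, |F mu t y - F lam t y| ≤ |mu - lam|)
    (hdom : ∀ lam a, a ∈ poincareDomain (F lam) T) :
    Continuous fun q : ℝ × ℝ => poincareMap (F q.1) T q.2 := by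
  refine continuous_iff_continuousAt.2 fun q => tendsto_iff_dist_tendsto_zero.2 ?_
  have hbound : ∀ r : ℝ × ℝ, dist (poincareMap (F r.1) T r.2) (poincareMap (F q.1) T q.2) ≤
      gronwallBound |q.2 - r.2| K |r.1 - q.1| T := fun r => by
    obtain ⟨u, hu, hu0, huT⟩ := exists_isSolutionOn_of_mem_poincareDomain (hdom q.1 q.2)
    obtain ⟨v, hv, hv0, hvT⟩ := exists_isSolutionOn_of_mem_poincareDomain (hdom r.1 r.2)
    rw [dist_comm, ← huT, ← hvT, ← hu0, ← hv0]
    exact abs_sub_le_gronwallBound hT (hK q.1) (fun t y => hlam q.1 r.1 t y) hu hv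
  have hlim : Tendsto (fun r : ℝ × ℝ => gronwallBound |q.2 - r.2| K |r.1 - q.1| T)
      (𝓝 q) (𝓝 0) := by
    have hc : Continuous fun r : ℝ × ℝ => gronwallBound |q.2 - r.2| K |r.1 - q.1| T :=
      (continuous_gronwallBound K T).comp
        (f := fun r : ℝ × ℝ => (|q.2 - r.2|, |r.1 - q.1|)) (by fun_prop)
    simpa [gronwallBound_ε0_δ0] using hc.tendsto q
  exact squeeze_zero (fun _ => dist_nonneg) hbound hlim

theorem IsPeriodicSolution.poincareMap_eq {K : NNReal} (hT : 0 ≤ T)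
    (hK : ∀ t, LipschitzWith K (f t)) (hφ : IsPeriodicSolution f T φ) :
    poincareMap f T (φ 0) = φ 0 := by
  have hφT := hφ.1.mono (subset_univ (Icc 0 T))
  refine (poincareMap_eq_of_unique hφT fun v hv hv0 => ?_).trans hφ.2.eq
  have hle := abs_sub_le_gronwallBound (ε := 0) hT hK (by simp) hv hφT
  rw [hv0, sub_self, abs_zero, gronwallBound_ε0_δ0] at hle
  exact sub_eq_zero.1 (abs_nonpos_iff.1 hle)

theorem exists_isPeriodicSolution_of_poincareMap_eq {a : ℝ} (hT : 0 < T)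
    (hf : Continuous (Function.uncurry f)) (hp : Function.Periodic f T)
    (ha : a ∈ poincareDomain f T) (hfix : poincareMap f T a = a) :
    ∃ φ, IsPeriodicSolution f T φ := by
  obtain ⟨u, hu, hu0, huT⟩ := exists_isSolutionOn_of_mem_poincareDomain ha
  obtain ⟨φ, hφ, -⟩ := exists_isPeriodicSolution_eqOn hT hf hp hu (by rw [hu0, huT, hfix])
  exact ⟨φ, hφ⟩

theorem poincareMap_le_of_strict_upper_solution {p p' : ℝ → ℝ} (hT : 0 ≤ T)
    (hdom : p 0 ∈ poincareDomain f T) (hp : ∀ t, HasDerivAt p (p' t) t)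
    (hlt : ∀ t, f t (p t) < p' t) : poincareMap f T (p 0) ≤ p T := by
  obtain ⟨u, hu, hu0, huT⟩ := exists_isSolutionOn_of_mem_poincareDomain hdom
  rw [← huT]
  refine image_le_of_deriv_right_lt_deriv_boundary hu.continuousOn hu.hasDerivWithinAt_Ici hu0.le
    hp (fun t _ hup => ?_) ⟨hT, le_rfl⟩
  rw [hup]
  exact hlt t

theorem le_poincareMap_of_strict_lower_solution {r r' : ℝ → ℝ} (hT : 0 ≤ T)
    (hdom : r 0 ∈ poincareDomain f T) (hr : ∀ t, HasDerivAt r (r' t) t)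
    (hlt : ∀ t, r' t < f t (r t)) : r T ≤ poincareMap f T (r 0) := by
  obtain ⟨u, hu, hu0, huT⟩ := exists_isSolutionOn_of_mem_poincareDomain hdom
  rw [← huT]
  refine image_le_of_deriv_right_lt_deriv_boundary'
    (fun t _ => (hr t).continuousAt.continuousWithinAt) (fun t _ => (hr t).hasDerivWithinAt)
    hu0.ge hu.continuousOn hu.hasDerivWithinAt_Ici (fun t _ hru => ?_) ⟨hT, le_rfl⟩
  rw [← hru]
  exact hlt t

theorem exists_isPeriodicSolution_of_strict_upper_lower {p p' r r' : ℝ → ℝ} (hT : 0 < T)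
    (hf : Continuous (Function.uncurry f)) (hfp : Function.Periodic f T)
    (hdom : ∀ a, a ∈ poincareDomain f T) (hP : Continuous (poincareMap f T))
    (hp : ∀ t, HasDerivAt p (p' t) t) (hpp : Function.Periodic p T) (hpf : ∀ t, f t (p t) < p' t)
    (hr : ∀ t, HasDerivAt r (r' t) t) (hrp : Function.Periodic r T)
    (hrf : ∀ t, r' t < f t (r t)) : ∃ φ, IsPeriodicSolution f T φ := by
  have hupper : poincareMap f T (p 0) - p 0 ≤ 0 :=
    sub_nonpos.2 <|
      (poincareMap_le_of_strict_upper_solution hT.le (hdom _) hp hpf).trans_eq hpp.eq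
  have hlower : 0 ≤ poincareMap f T (r 0) - r 0 :=
    sub_nonneg.2 <|
      hrp.eq.ge.trans (le_poincareMap_of_strict_lower_solution hT.le (hdom _) hr hrf)
  obtain ⟨a, ha⟩ := mem_range_of_exists_le_of_exists_ge (hP.sub continuous_id) ⟨p 0, hupper⟩
    ⟨r 0, hlower⟩
  exact exists_isPeriodicSolution_of_poincareMap_eq hT hf hfp (hdom a) (sub_eq_zero.1 ha)

theorem IsPeriodicSolution.abs_le_of_ne_zero {M : ℝ} (hT : T ≠ 0) (hM : 0 ≤ M)
    (hφ : IsPeriodicSolution f T φ) (hf : ∀ t y, M < |y| → f t y ≠ 0) (t : ℝ) : |φ t| ≤ M := by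
  obtain ⟨_, ⟨s, rfl⟩, hs⟩ := ((hφ.2.comp (· ^ 2)).compact_of_continuous hT
    ((continuous_pow 2).comp hφ.1.continuous)).exists_isGreatest (range_nonempty _)
  have hmax : ∀ t, φ t ^ 2 ≤ φ s ^ 2 := fun t => hs (mem_range_self t)
  have hzero : 2 * φ s ^ 1 * f s (φ s) = 0 :=
    IsLocalMax.hasDerivAt_eq_zero (Eventually.of_forall hmax) ((hφ.1.hasDerivAt s).pow 2)
  refine (sq_le_sq.1 (hmax t)).trans (not_lt.1 fun hlt => ?_)
  exact mul_ne_zero (mul_ne_zero two_ne_zero (pow_ne_zero _ (abs_pos.1 (hM.trans_lt hlt))))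
    (hf s _ hlt) hzero

end Scalar

/-! ### The flow of a Riccati equation around a known solution -/

/-- The solution with value `1` at time `0` of the variational equation of `riccati a₂ a₁ a₀`
along a solution `x`. Its value at a period of `x` is the characteristic multiplier of `x`. -/
def variation (a₂ a₁ x : ℝ → ℝ) (t : ℝ) : ℝ :=
  Real.exp (∫ s in (0 : ℝ)..t, (2 * a₂ s * x s + a₁ s))

/-- The primitive of `a₂ * variation a₂ a₁ x`, which governs the nonlinear part of the flow of
`riccati a₂ a₁ a₀` around `x`. -/
def variationIntegral (a₂ a₁ x : ℝ → ℝ) (t : ℝ) : ℝ :=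
  ∫ s in (0 : ℝ)..t, a₂ s * variation a₂ a₁ x s

/-- The difference at time `t` between the solution of `riccati a₂ a₁ a₀` starting at `x 0 + h`
and the solution `x`. It is meaningful up to the first zero of the denominator, where the
former solution blows up. -/
def deviation (a₂ a₁ x : ℝ → ℝ) (h t : ℝ) : ℝ :=
  h * variation a₂ a₁ x t / (1 - h * variationIntegral a₂ a₁ x t)

theorem continuous_uncurry_riccati {a₂ a₁ a₀ : ℝ → ℝ} (h₂ : Continuous a₂) (h₁ : Continuous a₁)
    (h₀ : Continuous a₀) : Continuous (Function.uncurry (riccati a₂ a₁ a₀)) := by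
  simp only [Function.uncurry_def, riccati]
  fun_prop

theorem periodic_riccati {a₂ a₁ a₀ : ℝ → ℝ} {T : ℝ} (hp₂ : Function.Periodic a₂ T)
    (hp₁ : Function.Periodic a₁ T) (hp₀ : Function.Periodic a₀ T) :
    Function.Periodic (riccati a₂ a₁ a₀) T := fun t => by
  funext y
  simp only [riccati, hp₂ t, hp₁ t, hp₀ t]

theorem eq_zero_of_linear_ode {k d : ℝ → ℝ} {T : ℝ} (hk : ContinuousOn k (Icc 0 T))
    (hd : IsSolutionOn (fun t y => k t * y) (Icc 0 T) d) (h0 : d 0 = 0) :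
    ∀ t ∈ Icc 0 T, d t = 0 := by
  obtain ⟨K, hK⟩ := isCompact_Icc.exists_bound_of_continuousOn hk
  refine eq_zero_of_abs_deriv_le_mul_abs_self_of_eq_zero_right (K := K) hd.continuousOn
    hd.hasDerivWithinAt_Ici h0 fun t ht => ?_
  rw [norm_mul]
  exact mul_le_mul_of_nonneg_right (hK t (Ico_subset_Icc_self ht)) (norm_nonneg _)

section Flow

variable {a₂ a₁ a₀ x : ℝ → ℝ} {T : ℝ}

theorem variation_pos (a₂ a₁ x : ℝ → ℝ) (t : ℝ) : 0 < variation a₂ a₁ x t := Real.exp_pos _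

theorem variation_zero (a₂ a₁ x : ℝ → ℝ) : variation a₂ a₁ x 0 = 1 := by simp [variation]

theorem variationIntegral_zero (a₂ a₁ x : ℝ → ℝ) : variationIntegral a₂ a₁ x 0 = 0 :=
  intervalIntegral.integral_same

theorem deviation_zero (a₂ a₁ x : ℝ → ℝ) (h : ℝ) : deviation a₂ a₁ x h 0 = h := by
  simp [deviation, variation_zero, variationIntegral_zero]

theorem hasDerivAt_variation (h₂ : Continuous a₂) (h₁ : Continuous a₁) (hx : Continuous x)
    (t : ℝ) : HasDerivAt (variation a₂ a₁ x)
      ((2 * a₂ t * x t + a₁ t) * variation a₂ a₁ x t) t := by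
  rw [mul_comm]
  exact (hasDerivAt_primitive (k := fun s => 2 * a₂ s * x s + a₁ s) (by fun_prop) t).exp

theorem continuous_variation (h₂ : Continuous a₂) (h₁ : Continuous a₁) (hx : Continuous x) :
    Continuous (variation a₂ a₁ x) :=
  continuous_iff_continuousAt.2 fun t => (hasDerivAt_variation h₂ h₁ hx t).continuousAt

theorem hasDerivAt_variationIntegral (h₂ : Continuous a₂) (h₁ : Continuous a₁)
    (hx : Continuous x) (t : ℝ) :
    HasDerivAt (variationIntegral a₂ a₁ x) (a₂ t * variation a₂ a₁ x t) t :=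
  hasDerivAt_primitive (h₂.mul (continuous_variation h₂ h₁ hx)) t

theorem continuous_variationIntegral (h₂ : Continuous a₂) (h₁ : Continuous a₁)
    (hx : Continuous x) : Continuous (variationIntegral a₂ a₁ x) :=
  continuous_iff_continuousAt.2 fun t => (hasDerivAt_variationIntegral h₂ h₁ hx t).continuousAt

theorem periodic_variation (h₂ : Continuous a₂) (h₁ : Continuous a₁) (hx : Continuous x)
    (hp₂ : Function.Periodic a₂ T) (hp₁ : Function.Periodic a₁ T) (hpx : Function.Periodic x T)
    (hm : variation a₂ a₁ x T = 1) : Function.Periodic (variation a₂ a₁ x) T :=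
  (periodic_primitive (k := fun s => 2 * a₂ s * x s + a₁ s) (by fun_prop)
    (fun t => by simp only [hp₂ t, hp₁ t, hpx t]) ((Real.exp_eq_one_iff _).1 hm)).comp Real.exp

theorem isSolutionOn_add_deviation {s : Set ℝ} {h : ℝ} (h₂ : Continuous a₂) (h₁ : Continuous a₁)
    (hx : IsSolutionOn (riccati a₂ a₁ a₀) univ x)
    (hne : ∀ t ∈ s, 1 - h * variationIntegral a₂ a₁ x t ≠ 0) :
    IsSolutionOn (riccati a₂ a₁ a₀) s (fun t => x t + deviation a₂ a₁ x h t) := fun t ht => by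
  have hV := (hasDerivAt_variation h₂ h₁ hx.continuous t).const_mul h
  have hG := ((hasDerivAt_variationIntegral h₂ h₁ hx.continuous t).const_mul h).const_sub 1
  refine (((hx.hasDerivAt t).add (hV.div hG (hne t ht))).congr_deriv ?_).hasDerivWithinAt
  have hden := hne t ht
  simp only [riccati, deviation]
  field_simp
  ring

/-- Cleared of denominators, the relation needs no a priori knowledge that the denominator of
`deviation` is nonzero: both sides agree at `0`, and their difference solves a linear equation. -/
theorem riccati_solution_relation (h₂ : Continuous a₂) (h₁ : Continuous a₁)
    (hx : IsSolutionOn (riccati a₂ a₁ a₀) univ x) {u : ℝ → ℝ}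
    (hu : IsSolutionOn (riccati a₂ a₁ a₀) (Icc 0 T) u) {t : ℝ} (ht : t ∈ Icc 0 T) :
    (u t - x t) * (1 - (u 0 - x 0) * variationIntegral a₂ a₁ x t)
      = (u 0 - x 0) * variation a₂ a₁ x t := by
  have hxc := hx.continuous
  have huc := hu.continuousOn
  set h := u 0 - x 0
  refine sub_eq_zero.1 (eq_zero_of_linear_ode
    (k := fun t => a₂ t * (u t - x t) + (2 * a₂ t * x t + a₁ t))
    (d := fun t => (u t - x t) * (1 - h * variationIntegral a₂ a₁ x t)
      - h * variation a₂ a₁ x t) (by fun_prop) (fun t ht => ?_)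
    (by simp [variation_zero, variationIntegral_zero, h]) t ht)
  have hV := ((hasDerivAt_variation h₂ h₁ hxc t).const_mul h).hasDerivWithinAt (s := Icc 0 T)
  have hG := (((hasDerivAt_variationIntegral h₂ h₁ hxc t).const_mul h).const_sub
    1).hasDerivWithinAt (s := Icc 0 T)
  refine ((((hu t ht).sub (hx.hasDerivAt t).hasDerivWithinAt).mul hG).sub hV).congr_deriv ?_
  simp only [riccati, Pi.sub_apply]
  ring

theorem riccati_solution_eq_add_deviation (h₂ : Continuous a₂) (h₁ : Continuous a₁)
    (hx : IsSolutionOn (riccati a₂ a₁ a₀) univ x) {u : ℝ → ℝ}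
    (hu : IsSolutionOn (riccati a₂ a₁ a₀) (Icc 0 T) u) {t : ℝ} (ht : t ∈ Icc 0 T)
    (hne : 1 - (u 0 - x 0) * variationIntegral a₂ a₁ x t ≠ 0) :
    u t = x t + deviation a₂ a₁ x (u 0 - x 0) t := by
  rw [deviation, ← riccati_solution_relation h₂ h₁ hx hu ht, mul_div_cancel_right₀ _ hne]
  ring

theorem exists_variationIntegral_eq (h₂ : Continuous a₂) (h₁ : Continuous a₁)
    (hx : Continuous x) (t : ℝ) :
    ∃ c, variationIntegral a₂ a₁ x t = a₂ c * variation a₂ a₁ x c * t := by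
  have hG := hasDerivAt_variationIntegral h₂ h₁ hx
  have hc := continuous_variationIntegral h₂ h₁ hx
  rcases lt_trichotomy t 0 with ht | rfl | ht
  · obtain ⟨c, -, hslope⟩ := exists_hasDerivAt_eq_slope _ _ ht hc.continuousOn fun s _ => hG s
    refine ⟨c, ?_⟩
    rw [hslope, variationIntegral_zero]
    field_simp [ht.ne]
    ring
  · exact ⟨0, by rw [variationIntegral_zero, mul_zero]⟩
  · obtain ⟨c, -, hslope⟩ := exists_hasDerivAt_eq_slope _ _ ht hc.continuousOn fun s _ => hG s
    refine ⟨c, ?_⟩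
    rw [hslope, variationIntegral_zero, sub_zero, sub_zero, div_mul_cancel₀ _ ht.ne']

theorem variationIntegral_ne_zero (h₂ : Continuous a₂) (h₁ : Continuous a₁) (hx : Continuous x)
    (hne : ∀ t, a₂ t ≠ 0) {t : ℝ} (ht : t ≠ 0) : variationIntegral a₂ a₁ x t ≠ 0 := by
  obtain ⟨c, hc⟩ := exists_variationIntegral_eq h₂ h₁ hx t
  rw [hc]
  exact mul_ne_zero (mul_ne_zero (hne c) (variation_pos a₂ a₁ x c).ne') ht

theorem variationIntegral_mem_uIcc (h₂ : Continuous a₂) (h₁ : Continuous a₁) (hx : Continuous x)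
    (hne : ∀ t, a₂ t ≠ 0) {t : ℝ} (ht : t ∈ Icc 0 T) :
    variationIntegral a₂ a₁ x t ∈ uIcc 0 (variationIntegral a₂ a₁ x T) := by
  have hG := hasDerivAt_variationIntegral h₂ h₁ hx
  rw [← variationIntegral_zero a₂ a₁ x]
  rcases forall_pos_or_forall_neg h₂ hne with hpos | hneg
  · have hmono : Monotone (variationIntegral a₂ a₁ x) := monotone_of_hasDerivAt_nonneg hG
      fun s => (mul_pos (hpos s) (variation_pos a₂ a₁ x s)).le
    exact hmono.mapsTo_uIcc (Icc_subset_uIcc ht)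
  · have hanti : Antitone (variationIntegral a₂ a₁ x) := antitone_of_hasDerivAt_nonpos hG
      fun s => (mul_neg_of_neg_of_pos (hneg s) (variation_pos a₂ a₁ x s)).le
    exact hanti.mapsTo_uIcc (Icc_subset_uIcc ht)

theorem one_sub_mul_pos_of_mem_uIcc {h g c : ℝ} (hg : g ∈ uIcc 0 c) (hc : 0 < 1 - h * c) :
    0 < 1 - h * g := by
  have hmem : h * g ∈ uIcc (h * 0) (h * c) := by
    rw [← image_const_mul_uIcc]
    exact mem_image_of_mem _ hg
  have hlt : max (h * 0) (h * c) < 1 := max_lt (by simp) (by linarith)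
  linarith [hmem.2]

theorem eventually_forall_one_sub_mul_pos {G : ℝ → ℝ} (hG : Continuous G) (T x₀ : ℝ) :
    ∀ᶠ y in 𝓝 x₀, ∀ t ∈ Icc 0 T, 0 < 1 - (y - x₀) * G t := by
  refine isCompact_Icc.eventually_forall_of_forall_eventually fun t _ => ?_
  have hcont : Continuous fun q : ℝ × ℝ => 1 - (q.1 - x₀) * G q.2 := by fun_prop
  exact hcont.continuousAt.eventually_const_lt (by simp)

theorem eventually_displacement_riccati_eq (h₂ : Continuous a₂) (h₁ : Continuous a₁)
    (hx : IsSolutionOn (riccati a₂ a₁ a₀) univ x) (hT : 0 ≤ T) :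
    ∀ᶠ y in 𝓝 (x 0), y ∈ poincareDomain (riccati a₂ a₁ a₀) T ∧
      displacement (riccati a₂ a₁ a₀) T y = x T + deviation a₂ a₁ x (y - x 0) T - y := by
  filter_upwards [eventually_forall_one_sub_mul_pos
    (continuous_variationIntegral h₂ h₁ hx.continuous) T (x 0)] with y hy
  have hdom : y ∈ poincareDomain (riccati a₂ a₁ a₀) T :=
    ⟨_, isSolutionOn_add_deviation h₂ h₁ hx fun t ht => (hy t ht).ne', by
      rw [deviation_zero, add_sub_cancel]⟩
  obtain ⟨u, hu, rfl, huT⟩ := exists_isSolutionOn_of_mem_poincareDomain hdom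
  have hmem : T ∈ Icc 0 T := ⟨hT, le_rfl⟩
  refine ⟨hdom, ?_⟩
  rw [displacement, ← huT,
    riccati_solution_eq_add_deviation h₂ h₁ hx hu hmem (hy T hmem).ne']

end Flow

theorem moebius_displacement_jet (m c x₀ : ℝ) :
    let D : ℝ → ℝ := fun y => x₀ + (y - x₀) * m / (1 - (y - x₀) * c) - y
    ContDiffAt ℝ 2 D x₀ ∧ D x₀ = 0 ∧ iteratedDeriv 1 D x₀ = m - 1 ∧
      iteratedDeriv 2 D x₀ = 2 * m * c := by
  intro D
  have hden : ∀ y, HasDerivAt (fun y => 1 - (y - x₀) * c) (-(1 * c)) y := fun y =>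
    (((hasDerivAt_id y).sub_const x₀).mul_const c).const_sub 1
  have hderiv : deriv D =ᶠ[𝓝 x₀] fun y => m / (1 - (y - x₀) * c) ^ 2 - 1 := by
    have hne : ∀ᶠ y in 𝓝 x₀, 1 - (y - x₀) * c ≠ 0 :=
      ContinuousAt.eventually_ne (by fun_prop) (by simp)
    filter_upwards [hne] with y hy
    have hnum := ((hasDerivAt_id y).sub_const x₀).mul_const m
    refine HasDerivAt.deriv
      ((((hnum.div (hden y) hy).const_add x₀).sub (hasDerivAt_id y)).congr_deriv ?_)
    simp only [id]
    field_simp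
    ring
  refine ⟨?_, by simp [D], ?_, ?_⟩
  · exact (contDiffAt_const.add (ContDiffAt.div (by fun_prop) (by fun_prop) (by simp))).sub
      contDiffAt_id
  · rw [iteratedDeriv_one, hderiv.eq_of_nhds]
    simp
  · rw [iteratedDeriv_succ, iteratedDeriv_one, hderiv.deriv_eq]
    refine ((((hasDerivAt_const x₀ m).div ((hden x₀).pow 2) (by simp)).sub_const
      1).congr_deriv ?_).deriv
    simp only [Pi.pow_apply, sub_self, zero_mul, sub_zero, one_pow, mul_one, Nat.cast_ofNat,
      Nat.add_one_sub_one, one_mul, mul_neg, sub_neg_eq_add, zero_add, div_one]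
    ring

/-! ### Periodic solutions of a Riccati equation with one known periodic solution -/

section Periodic

variable {a₂ a₁ a₀ x ψ : ℝ → ℝ} {T : ℝ}

theorem IsPeriodicSolution.ext_riccati (h₂ : Continuous a₂) (h₁ : Continuous a₁) (hT : 0 < T)
    (hx : IsPeriodicSolution (riccati a₂ a₁ a₀) T x)
    (hψ : IsPeriodicSolution (riccati a₂ a₁ a₀) T ψ) (h0 : ψ 0 = x 0) : ψ = x := by
  refine eq_of_periodic_of_eqOn hT hψ.2 hx.2 fun t ht => ?_
  have hrel := riccati_solution_relation h₂ h₁ hx.1 (hψ.1.mono (subset_univ (Icc 0 T)))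
    (Ico_subset_Icc_self ht)
  rw [h0, sub_self, zero_mul, zero_mul, sub_zero, mul_one] at hrel
  exact sub_eq_zero.1 hrel

theorem IsPeriodicSolution.sub_ne_zero_of_ne (h₂ : Continuous a₂) (h₁ : Continuous a₁)
    (hT : 0 < T) (hx : IsPeriodicSolution (riccati a₂ a₁ a₀) T x)
    (hψ : IsPeriodicSolution (riccati a₂ a₁ a₀) T ψ) (hne : ψ ≠ x) (t : ℝ) :
    ψ t - x t ≠ 0 := by
  obtain ⟨s, hs, hts⟩ := (hψ.2.sub hx.2).exists_mem_Ico₀ hT t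
  have hrel := riccati_solution_relation h₂ h₁ hx.1 (hψ.1.mono (subset_univ (Icc 0 T)))
    (Ico_subset_Icc_self hs)
  have h0 : ψ 0 - x 0 ≠ 0 := fun h0 => hne (hx.ext_riccati h₂ h₁ hT hψ (sub_eq_zero.1 h0))
  rw [← Pi.sub_apply, hts, Pi.sub_apply]
  exact left_ne_zero_of_mul (hrel.trans_ne (mul_ne_zero h0 (variation_pos a₂ a₁ x s).ne'))

theorem IsPeriodicSolution.eq_or_sub_mul_eq (h₂ : Continuous a₂) (h₁ : Continuous a₁)
    (hT : 0 < T) (hx : IsPeriodicSolution (riccati a₂ a₁ a₀) T x)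
    (hψ : IsPeriodicSolution (riccati a₂ a₁ a₀) T ψ) :
    ψ = x ∨ (ψ 0 - x 0) * variationIntegral a₂ a₁ x T = 1 - variation a₂ a₁ x T := by
  have hrel := riccati_solution_relation h₂ h₁ hx.1 (hψ.1.mono (subset_univ (Icc 0 T)))
    (right_mem_Icc.2 hT.le)
  rw [hψ.2.eq, hx.2.eq] at hrel
  by_cases h0 : ψ 0 - x 0 = 0
  · exact Or.inl (hx.ext_riccati h₂ h₁ hT hψ (sub_eq_zero.1 h0))
  · exact Or.inr (by linarith [mul_left_cancel₀ h0 hrel])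

/-- The initial value of the second solution is the nonzero fixed point
`h = (1 - variation T) / variationIntegral T` of the Möbius map `h ↦ deviation h T`. -/
theorem exists_isPeriodicSolution_sub_mul_eq (h₂ : Continuous a₂) (h₁ : Continuous a₁)
    (h₀ : Continuous a₀) (hp₂ : Function.Periodic a₂ T) (hp₁ : Function.Periodic a₁ T)
    (hp₀ : Function.Periodic a₀ T) (hne : ∀ t, a₂ t ≠ 0) (hT : 0 < T)
    (hx : IsPeriodicSolution (riccati a₂ a₁ a₀) T x) :
    ∃ ψ, IsPeriodicSolution (riccati a₂ a₁ a₀) T ψ ∧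
      (ψ 0 - x 0) * variationIntegral a₂ a₁ x T = 1 - variation a₂ a₁ x T := by
  have hxc := hx.1.continuous
  have hm := variation_pos a₂ a₁ x T
  set h := (1 - variation a₂ a₁ x T) / variationIntegral a₂ a₁ x T
  have hhT : h * variationIntegral a₂ a₁ x T = 1 - variation a₂ a₁ x T :=
    div_mul_cancel₀ _ (variationIntegral_ne_zero h₂ h₁ hxc hne hT.ne')
  have hpos : ∀ t ∈ Icc 0 T, 0 < 1 - h * variationIntegral a₂ a₁ x t := fun t ht =>
    one_sub_mul_pos_of_mem_uIcc (variationIntegral_mem_uIcc h₂ h₁ hxc hne ht) (by linarith)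
  have hfix : deviation a₂ a₁ x h T = h := by
    rw [deviation, hhT, sub_sub_cancel, mul_div_cancel_right₀ _ hm.ne']
  obtain ⟨ψ, hψ, hψu⟩ := exists_isPeriodicSolution_eqOn hT (continuous_uncurry_riccati h₂ h₁ h₀)
    (periodic_riccati hp₂ hp₁ hp₀)
    (isSolutionOn_add_deviation h₂ h₁ hx.1 fun t ht => (hpos t ht).ne')
    (by rw [hx.2.eq, deviation_zero, hfix])
  refine ⟨ψ, hψ, ?_⟩
  rw [hψu (left_mem_Icc.2 hT.le)]
  beta_reduce
  rw [deviation_zero, add_sub_cancel_left, hhT]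

theorem displacement_riccati_jet (h₂ : Continuous a₂) (h₁ : Continuous a₁) (hT : 0 ≤ T)
    (hx : IsPeriodicSolution (riccati a₂ a₁ a₀) T x) :
    poincareDomain (riccati a₂ a₁ a₀) T ∈ 𝓝 (x 0) ∧
      ContDiffAt ℝ 2 (displacement (riccati a₂ a₁ a₀) T) (x 0) ∧
      displacement (riccati a₂ a₁ a₀) T (x 0) = 0 ∧
      iteratedDeriv 1 (displacement (riccati a₂ a₁ a₀) T) (x 0) = variation a₂ a₁ x T - 1 ∧
      iteratedDeriv 2 (displacement (riccati a₂ a₁ a₀) T) (x 0) =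
        2 * variation a₂ a₁ x T * variationIntegral a₂ a₁ x T := by
  have hev := eventually_displacement_riccati_eq h₂ h₁ hx.1 hT
  have hD := hev.mono fun _ hy => hy.2
  rw [hx.2.eq] at hD
  obtain ⟨hsmooth, hzero, hone, htwo⟩ := moebius_displacement_jet (variation a₂ a₁ x T)
    (variationIntegral a₂ a₁ x T) (x 0)
  exact ⟨hev.mono fun _ hy => hy.1, hsmooth.congr_of_eventuallyEq hD, hD.self_of_nhds.trans hzero,
    (EventuallyEq.iteratedDeriv_eq 1 hD).trans hone,
    (EventuallyEq.iteratedDeriv_eq 2 hD).trans htwo⟩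

theorem isZeroOfMultiplicity_one_of_variation_ne_one (h₂ : Continuous a₂) (h₁ : Continuous a₁)
    (hT : 0 ≤ T) (hx : IsPeriodicSolution (riccati a₂ a₁ a₀) T x)
    (hm : variation a₂ a₁ x T ≠ 1) : IsZeroOfMultiplicity (riccati a₂ a₁ a₀) T 1 (x 0) := by
  obtain ⟨hdom, hsmooth, hzero, hone, -⟩ := displacement_riccati_jet h₂ h₁ hT hx
  refine ⟨hdom, hsmooth.of_le (by norm_num), fun k hk => ?_, hone ▸ sub_ne_zero.2 hm⟩
  rwa [Nat.lt_one_iff.1 hk, iteratedDeriv_zero]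

theorem isZeroOfMultiplicity_two_of_variation_eq_one (h₂ : Continuous a₂) (h₁ : Continuous a₁)
    (hne : ∀ t, a₂ t ≠ 0) (hT : 0 < T) (hx : IsPeriodicSolution (riccati a₂ a₁ a₀) T x)
    (hm : variation a₂ a₁ x T = 1) : IsZeroOfMultiplicity (riccati a₂ a₁ a₀) T 2 (x 0) := by
  obtain ⟨hdom, hsmooth, hzero, hone, htwo⟩ := displacement_riccati_jet h₂ h₁ hT.le hx
  refine ⟨hdom, hsmooth, fun k hk => ?_, ?_⟩
  · interval_cases k
    · rwa [iteratedDeriv_zero]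
    · rw [hone, hm, sub_self]
  · rw [htwo, hm]
    simpa using variationIntegral_ne_zero h₂ h₁ hx.1.continuous hne hT.ne'

theorem isHyperbolicLimitCycle_of_variation_ne_one (h₂ : Continuous a₂) (h₁ : Continuous a₁)
    (hne : ∀ t, a₂ t ≠ 0) (hT : 0 < T) (hx : IsPeriodicSolution (riccati a₂ a₁ a₀) T x)
    (hm : variation a₂ a₁ x T ≠ 1) : IsHyperbolicLimitCycle (riccati a₂ a₁ a₀) T x := by
  have hc := variationIntegral_ne_zero h₂ h₁ hx.1.continuous hne hT.ne'
  refine ⟨⟨hx, |(1 - variation a₂ a₁ x T) / variationIntegral a₂ a₁ x T|,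
    abs_pos.2 (div_ne_zero (sub_ne_zero.2 hm.symm) hc), fun ψ hψ hlt => ?_⟩,
    isZeroOfMultiplicity_one_of_variation_ne_one h₂ h₁ hT.le hx hm⟩
  refine (hx.eq_or_sub_mul_eq h₂ h₁ hT hψ).resolve_right fun hrel => ?_
  rw [← hrel, mul_div_cancel_right₀ _ hc] at hlt
  exact hlt.false

theorem exists_two_hyperbolic_of_variation_ne_one (h₂ : Continuous a₂) (h₁ : Continuous a₁)
    (h₀ : Continuous a₀) (hp₂ : Function.Periodic a₂ T) (hp₁ : Function.Periodic a₁ T)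
    (hp₀ : Function.Periodic a₀ T) (hne : ∀ t, a₂ t ≠ 0) (hT : 0 < T)
    (hx : IsPeriodicSolution (riccati a₂ a₁ a₀) T x) (hm : variation a₂ a₁ x T ≠ 1) :
    ∃ ψ, x ≠ ψ ∧ {φ | IsPeriodicSolution (riccati a₂ a₁ a₀) T φ} = {x, ψ} ∧
      IsHyperbolicLimitCycle (riccati a₂ a₁ a₀) T x ∧
      IsHyperbolicLimitCycle (riccati a₂ a₁ a₀) T ψ := by
  obtain ⟨ψ, hψ, hψrel⟩ :=
    exists_isPeriodicSolution_sub_mul_eq h₂ h₁ h₀ hp₂ hp₁ hp₀ hne hT hx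
  have hc : ∀ {y : ℝ → ℝ}, Continuous y → variationIntegral a₂ a₁ y T ≠ 0 := fun hy =>
    variationIntegral_ne_zero h₂ h₁ hy hne hT.ne'
  have h0 : x 0 - ψ 0 ≠ 0 := fun h0 => hm <| by
    rw [sub_eq_zero.1 h0, sub_self, zero_mul] at hψrel
    linarith
  have hxψ : x ≠ ψ := fun h => h0 (by rw [h, sub_self])
  have hmψ : variation a₂ a₁ ψ T ≠ 1 := fun hmψ => by
    have hxrel := (hψ.eq_or_sub_mul_eq h₂ h₁ hT hx).resolve_left hxψ
    rw [hmψ, sub_self] at hxrel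
    exact mul_ne_zero h0 (hc hψ.1.continuous) hxrel
  refine ⟨ψ, hxψ, Subset.antisymm (fun φ hφ => ?_) (pair_subset hx hψ),
    isHyperbolicLimitCycle_of_variation_ne_one h₂ h₁ hne hT hx hm,
    isHyperbolicLimitCycle_of_variation_ne_one h₂ h₁ hne hT hψ hmψ⟩
  rcases hx.eq_or_sub_mul_eq h₂ h₁ hT hφ with rfl | hφrel
  · exact Or.inl rfl
  · have h0eq := mul_right_cancel₀ (hc hx.1.continuous) (hφrel.trans hψrel.symm)
    exact Or.inr (hψ.ext_riccati h₂ h₁ hT hφ (by linarith))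

theorem setOf_isPeriodicSolution_eq_singleton (h₂ : Continuous a₂) (h₁ : Continuous a₁)
    (hne : ∀ t, a₂ t ≠ 0) (hT : 0 < T) (hx : IsPeriodicSolution (riccati a₂ a₁ a₀) T x)
    (hm : variation a₂ a₁ x T = 1) : {ψ | IsPeriodicSolution (riccati a₂ a₁ a₀) T ψ} = {x} := by
  refine eq_singleton_iff_unique_mem.2 ⟨hx, fun ψ hψ => ?_⟩
  rcases hx.eq_or_sub_mul_eq h₂ h₁ hT hψ with h | hrel
  · exact h
  · rw [hm, sub_self, mul_eq_zero, sub_eq_zero] at hrel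
    exact hx.ext_riccati h₂ h₁ hT hψ
      (hrel.resolve_right (variationIntegral_ne_zero h₂ h₁ hx.1.continuous hne hT.ne'))

theorem isDoubleLimitCycle_of_variation_eq_one (h₂ : Continuous a₂) (h₁ : Continuous a₁)
    (hne : ∀ t, a₂ t ≠ 0) (hT : 0 < T) (hx : IsPeriodicSolution (riccati a₂ a₁ a₀) T x)
    (hm : variation a₂ a₁ x T = 1) : IsDoubleLimitCycle (riccati a₂ a₁ a₀) T x := by
  refine ⟨⟨hx, 1, one_pos, fun ψ hψ _ => ?_⟩,
    isZeroOfMultiplicity_two_of_variation_eq_one h₂ h₁ hne hT hx hm⟩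
  exact (setOf_isPeriodicSolution_eq_singleton h₂ h₁ hne hT hx hm).subset hψ

end Periodic

/-! ### Semi-stability -/

section SemiStable

variable {a₂ a₁ a₀ x : ℝ → ℝ} {T b B : ℝ}

theorem abs_deviation_le {h t : ℝ} (hb : 0 ≤ b) (hV : variation a₂ a₁ x t ≤ B)
    (hG : b * |t| ≤ |variationIntegral a₂ a₁ x t|)
    (hsign : h * variationIntegral a₂ a₁ x t ≤ 0) :
    |deviation a₂ a₁ x h t| ≤ |h| * B / (1 + |h| * (b * |t|)) := by
  have hden : 1 - h * variationIntegral a₂ a₁ x t = 1 + |h| * |variationIntegral a₂ a₁ x t| := by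
    rw [← abs_mul, abs_of_nonpos hsign, sub_eq_add_neg]
  have hB : 0 ≤ B := (variation_pos a₂ a₁ x t).le.trans hV
  have : 0 < 1 + |h| * (b * |t|) := by positivity
  rw [deviation, hden, abs_div, abs_mul, abs_of_pos (variation_pos a₂ a₁ x t),
    abs_of_pos (by positivity : 0 < 1 + |h| * |variationIntegral a₂ a₁ x t|)]
  gcongr

/-- The hyperbolic decay `|h| * B / (1 + |h| * b * |t|)` replaces the exponential one of the
hyperbolic case. -/
theorem exists_isSolutionOn_tendsto {s : Set ℝ} {l : Filter ℝ} {y : ℝ} (h₂ : Continuous a₂)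
    (h₁ : Continuous a₁) (hx : IsSolutionOn (riccati a₂ a₁ a₀) univ x) (hb : 0 < b)
    (hV : ∀ t, variation a₂ a₁ x t ≤ B)
    (hG : ∀ t, b * |t| ≤ |variationIntegral a₂ a₁ x t|) (hs : s ∈ l)
    (hl : Tendsto (fun t : ℝ => |t|) l atTop) (hy : y ≠ x 0)
    (hsign : ∀ t ∈ s, (y - x 0) * variationIntegral a₂ a₁ x t ≤ 0) :
    ∃ u, IsSolutionOn (riccati a₂ a₁ a₀) s u ∧ u 0 = y ∧
      (∀ t ∈ s, |u t - x t| ≤ |y - x 0| * B) ∧ Tendsto (fun t => u t - x t) l (𝓝 0) := by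
  have hB : 0 ≤ B := (variation_pos a₂ a₁ x 0).le.trans (hV 0)
  have hbound : ∀ t ∈ s, |deviation a₂ a₁ x (y - x 0) t| ≤
      |y - x 0| * B / (1 + |y - x 0| * (b * |t|)) := fun t ht =>
    abs_deviation_le hb.le (hV t) (hG t) (hsign t ht)
  have hlim : Tendsto (fun t : ℝ => |y - x 0| * B / (1 + |y - x 0| * (b * |t|))) l (𝓝 0) :=
    (tendsto_atTop_add_const_left _ _ ((hl.const_mul_atTop hb).const_mul_atTop
      (abs_pos.2 (sub_ne_zero.2 hy)))).const_div_atTop _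
  refine ⟨fun t => x t + deviation a₂ a₁ x (y - x 0) t,
    isSolutionOn_add_deviation h₂ h₁ hx fun t ht => by linarith [hsign t ht],
    by beta_reduce; rw [deviation_zero, add_sub_cancel], fun t ht => ?_, ?_⟩
  · rw [add_sub_cancel_left]
    refine (hbound t ht).trans (div_le_self (by positivity) ?_)
    have : 0 ≤ |y - x 0| * (b * |t|) := by positivity
    linarith
  · simp only [add_sub_cancel_left]
    exact squeeze_zero_norm' (mem_of_superset hs hbound) hlim

theorem exists_isSolutionOn_tendsto_of_side {s : Set ℝ} {l : Filter ℝ} {σ : ℝ}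
    (h₂ : Continuous a₂) (h₁ : Continuous a₁) (hx : IsSolutionOn (riccati a₂ a₁ a₀) univ x)
    (hb : 0 < b) (hV : ∀ t, variation a₂ a₁ x t ≤ B)
    (hG : ∀ t, b * |t| ≤ |variationIntegral a₂ a₁ x t|) (hs : s ∈ l)
    (hl : Tendsto (fun t : ℝ => |t|) l atTop) (hσ : |σ| = 1)
    (hsign : ∀ t ∈ s, σ * variationIntegral a₂ a₁ x t ≤ 0) :
    ∀ ε > 0, ∃ δ > 0, ∀ y, 0 < σ * (y - x 0) → σ * (y - x 0) < δ →
      ∃ u, IsSolutionOn (riccati a₂ a₁ a₀) s u ∧ u 0 = y ∧ (∀ t ∈ s, |u t - x t| < ε) ∧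
        Tendsto (fun t => u t - x t) l (𝓝 0) := by
  intro ε hε
  have hB : 0 < B := (variation_pos a₂ a₁ x 0).trans_le (hV 0)
  refine ⟨ε / B, div_pos hε hB, fun y hy hyδ => ?_⟩
  have habs : |y - x 0| = σ * (y - x 0) := by rw [← abs_of_pos hy, abs_mul, hσ, one_mul]
  have hsq : σ * σ = 1 := by rw [← abs_mul_abs_self, hσ, one_mul]
  have hsign' : ∀ t ∈ s, (y - x 0) * variationIntegral a₂ a₁ x t ≤ 0 := fun t ht => by
    calc (y - x 0) * variationIntegral a₂ a₁ x t
        = σ * (y - x 0) * (σ * variationIntegral a₂ a₁ x t) := by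
          rw [mul_mul_mul_comm, hsq, one_mul]
      _ ≤ 0 := mul_nonpos_of_nonneg_of_nonpos hy.le (hsign t ht)
  have hyx : y ≠ x 0 := fun h => by simp [h] at hy
  obtain ⟨u, hu, hu0, hbound, hlim⟩ :=
    exists_isSolutionOn_tendsto h₂ h₁ hx hb hV hG hs hl hyx hsign'
  refine ⟨u, hu, hu0, fun t ht => (hbound t ht).trans_lt ?_, hlim⟩
  rwa [habs, ← lt_div_iff₀ hB]

theorem exists_pos_mul_abs_le_abs_variationIntegral (h₂ : Continuous a₂) (h₁ : Continuous a₁)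
    (hx : Continuous x) (hp₂ : Function.Periodic a₂ T)
    (hV : Function.Periodic (variation a₂ a₁ x) T) (hne : ∀ t, a₂ t ≠ 0) (hT : T ≠ 0) :
    ∃ b > 0, ∀ t, b * |t| ≤ |variationIntegral a₂ a₁ x t| := by
  obtain ⟨b, hb, hle⟩ := exists_pos_forall_le_of_periodic
    (k := fun t => |a₂ t * variation a₂ a₁ x t|) hT
    (h₂.mul (continuous_variation h₂ h₁ hx)).abs (fun t => by simp only [hp₂ t, hV t])
    fun t => abs_pos.2 (mul_ne_zero (hne t) (variation_pos a₂ a₁ x t).ne')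
  refine ⟨b, hb, fun t => ?_⟩
  obtain ⟨c, hc⟩ := exists_variationIntegral_eq h₂ h₁ hx t
  rw [hc, abs_mul]
  exact mul_le_mul_of_nonneg_right (hle c) (abs_nonneg t)

theorem isSemiStable_of_variation_eq_one (h₂ : Continuous a₂) (h₁ : Continuous a₁)
    (hp₂ : Function.Periodic a₂ T) (hp₁ : Function.Periodic a₁ T)
    (hne : ∀ t, a₂ t ≠ 0) (hT : T ≠ 0) (hx : IsPeriodicSolution (riccati a₂ a₁ a₀) T x)
    (hm : variation a₂ a₁ x T = 1) : IsSemiStable (riccati a₂ a₁ a₀) x := by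
  have hxc := hx.1.continuous
  have hVp := periodic_variation h₂ h₁ hxc hp₂ hp₁ hx.2 hm
  obtain ⟨B, hB⟩ := exists_forall_abs_le_of_periodic hT (continuous_variation h₂ h₁ hxc) hVp
  obtain ⟨b, hb, hG⟩ := exists_pos_mul_abs_le_abs_variationIntegral h₂ h₁ hxc hp₂ hVp hne hT
  have hforward := fun (σ : ℝ) (hσ : |σ| = 1) => exists_isSolutionOn_tendsto_of_side h₂ h₁ hx.1 hb
    (fun t => (le_abs_self _).trans (hB t)) hG (Ici_mem_atTop 0) tendsto_abs_atTop_atTop hσ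
  have hbackward := fun (σ : ℝ) (hσ : |σ| = 1) => exists_isSolutionOn_tendsto_of_side h₂ h₁ hx.1 hb
    (fun t => (le_abs_self _).trans (hB t)) hG (Iic_mem_atBot 0) tendsto_abs_atBot_atTop hσ
  rcases forall_pos_or_forall_neg h₂ hne with hpos | hneg
  · have hVpos : ∀ c, 0 < a₂ c * variation a₂ a₁ x c := fun c =>
      mul_pos (hpos c) (variation_pos a₂ a₁ x c)
    refine Or.inr ⟨hforward (-1) (by simp) fun t (ht : 0 ≤ t) => ?_,
      hbackward 1 (by simp) fun t (ht : t ≤ 0) => ?_⟩ <;>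
    · obtain ⟨c, hc⟩ := exists_variationIntegral_eq h₂ h₁ hxc t
      rw [hc]
      nlinarith [hVpos c]
  · have hVneg : ∀ c, a₂ c * variation a₂ a₁ x c < 0 := fun c =>
      mul_neg_of_neg_of_pos (hneg c) (variation_pos a₂ a₁ x c)
    refine Or.inl ⟨hforward 1 (by simp) fun t (ht : 0 ≤ t) => ?_,
      hbackward (-1) (by simp) fun t (ht : t ≤ 0) => ?_⟩ <;>
    · obtain ⟨c, hc⟩ := exists_variationIntegral_eq h₂ h₁ hxc t
      rw [hc]
      nlinarith [hVneg c]

end SemiStable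

/-! ### The one-parameter family `y' = y ^ 2 + g(t) + lam` -/

/-- The right-hand side `y ^ 2 + g(t) + lam`, as a special Riccati equation. -/
def reduced (g : ℝ → ℝ) (lam : ℝ) : ℝ → ℝ → ℝ :=
  riccati (fun _ => 1) (fun _ => 0) fun t => g t + lam

/-- The globally Lipschitz modification of `reduced g lam` in which `|y|` is cut off at `M`. For
large `M` it has the same periodic solutions. -/
def truncated (M : ℝ) (g : ℝ → ℝ) (lam t y : ℝ) : ℝ := min |y| M ^ 2 + g t + lam

section Truncation

variable {T M lam : ℝ} {g φ : ℝ → ℝ}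

theorem reduced_apply (g : ℝ → ℝ) (lam t y : ℝ) : reduced g lam t y = y ^ 2 + g t + lam := by
  simp only [reduced, riccati]
  ring

theorem truncated_eq_reduced {t y : ℝ} (hy : |y| ≤ M) :
    truncated M g lam t y = reduced g lam t y := by
  rw [truncated, reduced_apply, min_eq_left hy, sq_abs]

theorem truncated_eq_of_le_abs {t y : ℝ} (hy : M ≤ |y|) :
    truncated M g lam t y = M ^ 2 + g t + lam := by
  rw [truncated, min_eq_right hy]

theorem continuous_uncurry_truncated (hg : Continuous g) :
    Continuous (Function.uncurry (truncated M g lam)) := by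
  simp only [Function.uncurry_def, truncated]
  fun_prop

theorem periodic_truncated (hgp : Function.Periodic g T) :
    Function.Periodic (truncated M g lam) T := fun t => by
  funext y
  simp only [truncated, hgp t]

theorem lipschitzWith_truncated (hM : 0 ≤ M) (g : ℝ → ℝ) (lam t : ℝ) :
    LipschitzWith (2 * M).toNNReal (truncated M g lam t) := by
  refine LipschitzWith.of_dist_le_mul fun y z => ?_
  rw [Real.coe_toNNReal _ (by positivity), Real.dist_eq, Real.dist_eq, truncated, truncated,
    add_sub_add_right_eq_sub, add_sub_add_right_eq_sub, sq_sub_sq, abs_mul]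
  have hsum : |min |y| M + min |z| M| ≤ 2 * M := by
    rw [abs_of_nonneg (by positivity), two_mul]
    exact add_le_add (min_le_right _ _) (min_le_right _ _)
  have hdiff : |min |y| M - min |z| M| ≤ |y - z| :=
    (abs_min_sub_min_le_max _ _ _ _).trans
      (max_le (abs_abs_sub_abs_le y z) (by rw [sub_self, abs_zero]; exact abs_nonneg _))
  gcongr

theorem mem_poincareDomain_truncated (hT : 0 < T) (hM : 0 ≤ M) (hg : Continuous g)
    (hgp : Function.Periodic g T) (lam a : ℝ) : a ∈ poincareDomain (truncated M g lam) T := by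
  obtain ⟨B, hB⟩ := exists_forall_abs_le_of_periodic hT.ne' hg hgp
  refine mem_poincareDomain_of_lipschitzWith_of_bounded (L := M ^ 2 + B + |lam|) hT.le
    (fun y => (continuous_uncurry_truncated hg).comp (Continuous.prodMk_left y))
    (lipschitzWith_truncated hM g lam) (fun t y => ?_) a
  refine (abs_add_le _ _).trans (add_le_add_left ((abs_add_le _ _).trans
    (add_le_add ?_ (hB t))) _)
  rw [abs_of_nonneg (sq_nonneg _)]
  exact pow_le_pow_left₀ (le_min (abs_nonneg y) hM) (min_le_right _ _) 2

theorem continuous_poincareMap_truncated (hT : 0 < T) (hM : 0 ≤ M) (hg : Continuous g)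
    (hgp : Function.Periodic g T) :
    Continuous fun q : ℝ × ℝ => poincareMap (truncated M g q.1) T q.2 :=
  continuous_poincareMap_of_param hT.le (lipschitzWith_truncated hM g)
    (fun lam mu t y => by rw [truncated, truncated, add_sub_add_left_eq_sub])
    (mem_poincareDomain_truncated hT hM hg hgp)

theorem IsPeriodicSolution.abs_le_of_reduced (hT : T ≠ 0) (hM : 0 ≤ M)
    (hpos : ∀ t, 0 < M ^ 2 + g t + lam) (hφ : IsPeriodicSolution (reduced g lam) T φ) (t : ℝ) :
    |φ t| ≤ M := by
  refine hφ.abs_le_of_ne_zero hT hM (fun t y hy => ?_) t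
  rw [reduced_apply]
  have hsq : M ^ 2 < y ^ 2 := by rwa [sq_lt_sq, abs_of_nonneg hM]
  linarith [hpos t]

theorem isPeriodicSolution_truncated_iff (hT : T ≠ 0) (hM : 0 ≤ M)
    (hpos : ∀ t, 0 < M ^ 2 + g t + lam) :
    IsPeriodicSolution (truncated M g lam) T φ ↔ IsPeriodicSolution (reduced g lam) T φ := by
  constructor <;> intro hφ
  · have hle := hφ.abs_le_of_ne_zero hT hM fun t y hy => by
      rw [truncated_eq_of_le_abs hy.le]
      exact (hpos t).ne'
    exact ⟨fun t ht => truncated_eq_reduced (hle t) ▸ hφ.1 t ht, hφ.2⟩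
  · have hle := hφ.abs_le_of_reduced hT hM hpos
    exact ⟨fun t ht => truncated_eq_reduced (hle t) ▸ hφ.1 t ht, hφ.2⟩

theorem exists_isPeriodicSolution_reduced_iff (hT : 0 < T) (hM : 0 ≤ M) (hg : Continuous g)
    (hgp : Function.Periodic g T) (hpos : ∀ t, 0 < M ^ 2 + g t + lam) :
    (∃ φ, IsPeriodicSolution (reduced g lam) T φ) ↔
      ∃ a ∈ Icc (-M) M, poincareMap (truncated M g lam) T a = a := by
  constructor
  · rintro ⟨φ, hφ⟩
    exact ⟨φ 0, abs_le.1 (hφ.abs_le_of_reduced hT.ne' hM hpos 0),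
      ((isPeriodicSolution_truncated_iff hT.ne' hM hpos).2 hφ).poincareMap_eq hT.le
        (lipschitzWith_truncated hM g lam)⟩
  · rintro ⟨a, -, ha⟩
    obtain ⟨φ, hφ⟩ := exists_isPeriodicSolution_of_poincareMap_eq hT
      (continuous_uncurry_truncated hg) (periodic_truncated hgp)
      (mem_poincareDomain_truncated hT hM hg hgp lam a) ha
    exact ⟨φ, (isPeriodicSolution_truncated_iff hT.ne' hM hpos).1 hφ⟩

end Truncation

section Parameter

variable {T lam : ℝ} {g φ ψ : ℝ → ℝ}

/-- A large constant is a strict lower solution. -/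
theorem exists_isPeriodicSolution_reduced_of_strict_upper {p p' : ℝ → ℝ} (hT : 0 < T)
    (hg : Continuous g) (hgp : Function.Periodic g T) (hp : ∀ t, HasDerivAt p (p' t) t)
    (hpp : Function.Periodic p T) (hlt : ∀ t, p t ^ 2 + g t + lam < p' t) :
    ∃ φ, IsPeriodicSolution (reduced g lam) T φ := by
  have hpc : Continuous p := continuous_iff_continuousAt.2 fun t => (hp t).continuousAt
  obtain ⟨B, hB⟩ := exists_forall_abs_le_of_periodic hT.ne' hpc hpp
  obtain ⟨C, hC⟩ := exists_forall_abs_le_of_periodic hT.ne' hg hgp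
  have hB0 : 0 ≤ B := (abs_nonneg _).trans (hB 0)
  have hC0 : 0 ≤ C := (abs_nonneg _).trans (hC 0)
  set M := 1 + B + C + |lam|
  have hM : 0 ≤ M := by positivity
  have hpM : ∀ t, |p t| ≤ M := fun t => (hB t).trans (by linarith [abs_nonneg lam])
  have hpos : ∀ t, 0 < M ^ 2 + g t + lam := fun t => by
    nlinarith [neg_le_of_abs_le (hC t), neg_abs_le lam, abs_nonneg lam]
  obtain ⟨φ, hφ⟩ := exists_isPeriodicSolution_of_strict_upper_lower hT
    (continuous_uncurry_truncated hg) (periodic_truncated hgp)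
    (mem_poincareDomain_truncated hT hM hg hgp lam)
    ((continuous_poincareMap_truncated hT hM hg hgp).comp (Continuous.prodMk_right lam)) hp hpp
    (fun t => by
      rw [truncated_eq_reduced (hpM t), reduced_apply]
      exact hlt t)
    (r := fun _ => M) (r' := fun _ => 0) (fun t => hasDerivAt_const t M) (fun _ => rfl)
    (fun t => by
      rw [truncated_eq_of_le_abs (le_abs_self M)]
      exact hpos t)
  exact ⟨φ, (isPeriodicSolution_truncated_iff hT.ne' hM hpos).1 hφ⟩

theorem IsPeriodicSolution.reduced_param_le {B : ℝ} (hT : 0 < T) (hB : ∀ t, |g t| ≤ B)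
    (hφ : IsPeriodicSolution (reduced g lam) T φ) : lam ≤ B := by
  obtain ⟨s, -, hs⟩ := exists_hasDerivAt_eq_zero hT hφ.1.continuous.continuousOn hφ.2.eq.symm
    fun t _ => hφ.1.hasDerivAt t
  rw [reduced_apply] at hs
  linarith [sq_nonneg (φ s), neg_le_of_abs_le (hB s)]

theorem isCompact_setOf_exists_isPeriodicSolution_reduced (hT : 0 < T) (hg : Continuous g)
    (hgp : Function.Periodic g T) (m : ℝ) :
    IsCompact {lam | m ≤ lam ∧ ∃ φ, IsPeriodicSolution (reduced g lam) T φ} := by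
  obtain ⟨B, hB⟩ := exists_forall_abs_le_of_periodic hT.ne' hg hgp
  have hB0 : 0 ≤ B := (abs_nonneg _).trans (hB 0)
  set M := 1 + B + |m|
  have hM : 0 ≤ M := by positivity
  have hpos : ∀ lam, m ≤ lam → ∀ t, 0 < M ^ 2 + g t + lam := fun lam hlam t => by
    nlinarith [neg_le_of_abs_le (hB t), neg_abs_le m, abs_nonneg m]
  have hK : IsCompact ((Icc m B ×ˢ Icc (-M) M) ∩
      {q : ℝ × ℝ | poincareMap (truncated M g q.1) T q.2 = q.2}) :=
    (isCompact_Icc.prod isCompact_Icc).inter_right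
      (isClosed_eq (continuous_poincareMap_truncated hT hM hg hgp) continuous_snd)
  convert hK.image continuous_fst
  ext lam
  constructor
  · rintro ⟨hm, φ, hφ⟩
    obtain ⟨a, ha, hfix⟩ :=
      (exists_isPeriodicSolution_reduced_iff hT hM hg hgp (hpos lam hm)).1 ⟨φ, hφ⟩
    exact ⟨(lam, a), ⟨⟨⟨hm, hφ.reduced_param_le hT hB⟩, ha⟩, hfix⟩, rfl⟩
  · rintro ⟨⟨mu, a⟩, ⟨⟨hmu, ha⟩, hfix⟩, rfl⟩
    exact ⟨hmu.1, (exists_isPeriodicSolution_reduced_iff hT hM hg hgp (hpos mu hmu.1)).2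
      ⟨a, ha, hfix⟩⟩

theorem exists_isGreatest_reduced_param (hT : 0 < T) (hg : Continuous g)
    (hgp : Function.Periodic g T) :
    ∃ lam, IsGreatest {lam | ∃ φ, IsPeriodicSolution (reduced g lam) T φ} lam := by
  obtain ⟨B, hB⟩ := exists_forall_abs_le_of_periodic hT.ne' hg hgp
  have hm : ∃ φ, IsPeriodicSolution (reduced g (-(B + 1))) T φ :=
    exists_isPeriodicSolution_reduced_of_strict_upper (p := fun _ => 0) hT hg hgp
      (fun t => hasDerivAt_const t 0) (fun _ => rfl) fun t => by linarith [le_of_abs_le (hB t)]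
  obtain ⟨lam, ⟨hlam, hφ⟩, hmax⟩ :=
    (isCompact_setOf_exists_isPeriodicSolution_reduced hT hg hgp _).exists_isGreatest
      ⟨_, le_rfl, hm⟩
  refine ⟨lam, hφ, fun mu hmu => ?_⟩
  rcases le_total (-(B + 1)) mu with h | h
  · exact hmax ⟨h, hmu⟩
  · exact h.trans hlam

/-- By strict convexity of `y ^ 2`, the midpoint of two distinct periodic solutions is a strict
upper solution for slightly larger parameters. -/
theorem exists_reduced_param_gt_of_ne (hT : 0 < T) (hg : Continuous g)
    (hgp : Function.Periodic g T) (hφ : IsPeriodicSolution (reduced g lam) T φ)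
    (hψ : IsPeriodicSolution (reduced g lam) T ψ) (hne : ψ ≠ φ) :
    ∃ mu > lam, ∃ χ, IsPeriodicSolution (reduced g mu) T χ := by
  obtain ⟨b, hb, hle⟩ := exists_pos_forall_le_of_periodic (k := fun t => (ψ t - φ t) ^ 2) hT.ne'
    ((hψ.1.continuous.sub hφ.1.continuous).pow 2) (fun t => by simp only [hψ.2 t, hφ.2 t])
    fun t => sq_pos_of_ne_zero
      (hφ.sub_ne_zero_of_ne continuous_const continuous_const hT hψ hne t)
  refine ⟨lam + b / 8, by linarith, exists_isPeriodicSolution_reduced_of_strict_upper hT hg hgp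
    (fun t => ((hφ.1.hasDerivAt t).add (hψ.1.hasDerivAt t)).div_const 2)
    (fun t => by simp only [Pi.add_apply, hφ.2 t, hψ.2 t]) fun t => ?_⟩
  rw [reduced_apply, reduced_apply, Pi.add_apply]
  linarith [hle t]

theorem variation_reduced (φ : ℝ → ℝ) (T : ℝ) :
    variation (fun _ => 1) (fun _ => 0) φ T = Real.exp (2 * ∫ t in (0 : ℝ)..T, φ t) := by
  simp [variation]

theorem integral_eq_zero_of_reduced_param_maximal (hT : 0 < T) (hg : Continuous g)
    (hgp : Function.Periodic g T) (hφ : IsPeriodicSolution (reduced g lam) T φ)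
    (hmax : ∀ mu, (∃ ψ, IsPeriodicSolution (reduced g mu) T ψ) → mu ≤ lam) :
    ∫ t in (0 : ℝ)..T, φ t = 0 := by
  by_contra hmean
  have hm : variation (fun _ => 1) (fun _ => 0) φ T ≠ 1 := by
    rw [variation_reduced, Ne, Real.exp_eq_one_iff]
    exact mul_ne_zero two_ne_zero hmean
  obtain ⟨ψ, hψ, hrel⟩ := exists_isPeriodicSolution_sub_mul_eq continuous_const continuous_const
    (a₀ := fun t => g t + lam) (hg.add continuous_const) (fun _ => rfl) (fun _ => rfl)
    (fun t => by simp only [hgp t]) (fun _ => one_ne_zero) hT hφ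
  have hne : ψ ≠ φ := fun h => hm <| by
    rw [h, sub_self, zero_mul] at hrel
    linarith
  obtain ⟨mu, hmu, hχ⟩ := exists_reduced_param_gt_of_ne hT hg hgp hφ hψ hne
  exact hmu.not_ge (hmax mu hχ)

theorem exists_isPeriodicSolution_reduced_integral_eq_zero (hT : 0 < T) (hg : Continuous g)
    (hgp : Function.Periodic g T) :
    ∃ lam φ, IsPeriodicSolution (reduced g lam) T φ ∧ ∫ t in (0 : ℝ)..T, φ t = 0 := by
  obtain ⟨lam, ⟨φ, hφ⟩, hmax⟩ := exists_isGreatest_reduced_param hT hg hgp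
  exact ⟨lam, φ, hφ, integral_eq_zero_of_reduced_param_maximal hT hg hgp hφ hmax⟩

end Parameter

/-! ### Variational characterization of the critical parameter -/

section Weight

variable {q : ℝ → ℝ} {T : ℝ}

theorem weight_pos (q : ℝ → ℝ) (t : ℝ) : 0 < weight q t := Real.exp_pos _

theorem hasDerivAt_weight (hq : Continuous q) (t : ℝ) :
    HasDerivAt (weight q) (-2 * q t * weight q t) t := by
  rw [mul_comm]
  exact ((hasDerivAt_primitive hq t).const_mul (-2)).exp

theorem continuous_weight (hq : Continuous q) : Continuous (weight q) :=
  continuous_iff_continuousAt.2 fun t => (hasDerivAt_weight hq t).continuousAt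

theorem deriv_weight (hq : Continuous q) : deriv (weight q) = fun t => -2 * q t * weight q t :=
  funext fun t => (hasDerivAt_weight hq t).deriv

theorem contDiff_weight (hq : Continuous q) : ContDiff ℝ 1 (weight q) := by
  have hw := continuous_weight hq
  refine contDiff_one_iff_deriv.2 ⟨fun t => (hasDerivAt_weight hq t).differentiableAt, ?_⟩
  rw [deriv_weight hq]
  fun_prop

theorem periodic_weight (hT : T ≠ 0) (hq : q ∈ C1T0 T) : Function.Periodic (weight q) T :=
  (periodic_primitive hq.1.1.continuous hq.1.2
    ((average_eq_zero_iff hT q).1 hq.2)).comp fun y => Real.exp (-2 * y)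

theorem integral_weight_pos (hT : 0 < T) (hq : Continuous q) :
    0 < ∫ t in (0 : ℝ)..T, weight q t :=
  intervalIntegral.intervalIntegral_pos_of_pos
    ((continuous_weight hq).intervalIntegrable _ _) (weight_pos q) hT

end Weight

section Characterization

variable {T lam : ℝ} {γ g p q φ : ℝ → ℝ}

/-- The two integrands differ by the derivative of the periodic function `p * weight q`. -/
theorem integral_weight_mul_eq (hT : T ≠ 0) (hg : Continuous g) (hp : p ∈ C1T T)
    (hq : q ∈ C1T0 T) :
    ∫ t in (0 : ℝ)..T, weight q t * (q t ^ 2 - g t) =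
      ∫ t in (0 : ℝ)..T, weight q t * ((p t - q t) ^ 2 + (deriv p t - p t ^ 2 - g t)) := by
  have hqc := hq.1.1.continuous
  have hpc := hp.1.continuous
  have hwc := continuous_weight hqc
  have hp' := hp.1.continuous_deriv le_rfl
  have hzero := integral_deriv_eq_zero (hp.1.mul (contDiff_weight hqc))
    (hp.2.mul (periodic_weight hT hq))
  have hderiv : deriv (p * weight q) = fun t =>
      weight q t * ((p t - q t) ^ 2 + (deriv p t - p t ^ 2 - g t)) -
        weight q t * (q t ^ 2 - g t) := funext fun t => by
    rw [deriv_mul (hp.1.differentiable one_ne_zero t) (hasDerivAt_weight hqc t).differentiableAt,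
      deriv_weight hqc]
    ring
  change ∫ t in (0 : ℝ)..T, deriv (p * weight q) t = 0 at hzero
  rw [hderiv, intervalIntegral.integral_sub (Continuous.intervalIntegrable (by fun_prop) _ _)
    (Continuous.intervalIntegrable (by fun_prop) _ _)] at hzero
  exact (sub_eq_zero.1 hzero).symm

theorem continuous_centered (hγ : Continuous γ) : Continuous (centered T γ) :=
  hγ.sub continuous_const

theorem muLower_le_deriv_sub (hγ : Continuous γ) (hp : p ∈ C1T T) {t : ℝ} (ht : t ∈ Icc 0 T) :
    muLower T γ p ≤ deriv p t - p t ^ 2 - centered T γ t := by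
  have hpc := hp.1.continuous
  have hp' := hp.1.continuous_deriv le_rfl
  have hgc := continuous_centered (T := T) hγ
  have hle := le_csSup (isCompact_Icc.image (by fun_prop :
    Continuous fun t => p t ^ 2 + centered T γ t - deriv p t)).bddAbove (mem_image_of_mem _ ht)
  rw [muLower]
  linarith

theorem muLower_le_muUpper (hT : 0 < T) (hγ : Continuous γ) (hp : p ∈ C1T T)
    (hq : q ∈ C1T0 T) : muLower T γ p ≤ muUpper T γ q := by
  have hqc := hq.1.1.continuous
  have hpc := hp.1.continuous
  have hwc := continuous_weight hqc
  have hp' := hp.1.continuous_deriv le_rfl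
  have hgc := continuous_centered (T := T) hγ
  rw [muUpper, le_inv_mul_iff₀ (integral_weight_pos hT hqc),
    integral_weight_mul_eq hT.ne' hgc hp hq, ← intervalIntegral.integral_mul_const]
  refine intervalIntegral.integral_mono_on hT.le (Continuous.intervalIntegrable (by fun_prop) _ _)
    (Continuous.intervalIntegrable (by fun_prop) _ _) fun t ht => ?_
  refine mul_le_mul_of_nonneg_left ?_ (weight_pos q t).le
  linarith [muLower_le_deriv_sub hγ hp ht, sq_nonneg (p t - q t)]

theorem IsPeriodicSolution.deriv_reduced (hφ : IsPeriodicSolution (reduced g lam) T φ) :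
    deriv φ = fun t => φ t ^ 2 + g t + lam :=
  funext fun t => (hφ.1.hasDerivAt t).deriv.trans (reduced_apply g lam t (φ t))

theorem IsPeriodicSolution.mem_C1T (hg : Continuous g)
    (hφ : IsPeriodicSolution (reduced g lam) T φ) : φ ∈ C1T T := by
  have hc := hφ.1.continuous
  refine ⟨contDiff_one_iff_deriv.2 ⟨fun t => (hφ.1.hasDerivAt t).differentiableAt, ?_⟩, hφ.2⟩
  rw [hφ.deriv_reduced]
  fun_prop

theorem muLower_eq_of_isPeriodicSolution (hT : 0 ≤ T)
    (hφ : IsPeriodicSolution (reduced (centered T γ) lam) T φ) : muLower T γ φ = lam := by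
  have hconst : (fun t => φ t ^ 2 + centered T γ t - deriv φ t) = fun _ => -lam := by
    rw [hφ.deriv_reduced]
    ring_nf
  rw [muLower, hconst, (nonempty_Icc.2 hT).image_const, csSup_singleton, neg_neg]

theorem muUpper_eq_of_isPeriodicSolution (hT : 0 < T) (hγ : Continuous γ)
    (hφ : IsPeriodicSolution (reduced (centered T γ) lam) T φ) (hφ0 : φ ∈ C1T0 T) :
    muUpper T γ φ = lam := by
  have hpos := integral_weight_pos hT hφ.1.continuous
  have hconst : ∀ t, (φ t - φ t) ^ 2 + (deriv φ t - φ t ^ 2 - centered T γ t) = lam := fun t => by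
    rw [hφ.deriv_reduced]
    ring
  rw [muUpper, integral_weight_mul_eq hT.ne' (continuous_centered hγ) hφ0.1 hφ0]
  simp only [hconst]
  rw [intervalIntegral.integral_mul_const, inv_mul_cancel_left₀ hpos.ne']

theorem isGreatest_muLower (hT : 0 < T) (hγ : Continuous γ)
    (hφ : IsPeriodicSolution (reduced (centered T γ) lam) T φ)
    (hmean : ∫ t in (0 : ℝ)..T, φ t = 0) : IsGreatest (muLower T γ '' C1T T) lam := by
  have hφC := hφ.mem_C1T (continuous_centered hγ)
  have hφ0 : φ ∈ C1T0 T := ⟨hφC, (average_eq_zero_iff hT.ne' φ).2 hmean⟩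
  refine ⟨⟨φ, hφC, muLower_eq_of_isPeriodicSolution hT.le hφ⟩, forall_mem_image.2 fun p hp => ?_⟩
  exact (muLower_le_muUpper hT hγ hp hφ0).trans_eq (muUpper_eq_of_isPeriodicSolution hT hγ hφ hφ0)

theorem isLeast_muUpper (hT : 0 < T) (hγ : Continuous γ)
    (hφ : IsPeriodicSolution (reduced (centered T γ) lam) T φ)
    (hmean : ∫ t in (0 : ℝ)..T, φ t = 0) : IsLeast (muUpper T γ '' C1T0 T) lam := by
  have hφC := hφ.mem_C1T (continuous_centered hγ)
  have hφ0 : φ ∈ C1T0 T := ⟨hφC, (average_eq_zero_iff hT.ne' φ).2 hmean⟩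
  refine ⟨⟨φ, hφ0, muUpper_eq_of_isPeriodicSolution hT hγ hφ hφ0⟩,
    forall_mem_image.2 fun q hq => ?_⟩
  exact (muLower_eq_of_isPeriodicSolution hT.le hφ).ge.trans (muLower_le_muUpper hT hγ hφC hq)

theorem gammaStar_eq (hT : 0 < T) (hγ : Continuous γ)
    (hφ : IsPeriodicSolution (reduced (centered T γ) lam) T φ)
    (hmean : ∫ t in (0 : ℝ)..T, φ t = 0) : gammaStar T γ = lam :=
  (isGreatest_muLower hT hγ hφ hmean).csSup_eq

theorem periodic_centered (hγp : Function.Periodic γ T) :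
    Function.Periodic (centered T γ) T := fun t => by
  simp only [centered, hγp t]

theorem exists_isPeriodicSolution_reduced_gammaStar (hT : 0 < T) (hγ : Continuous γ)
    (hγp : Function.Periodic γ T) :
    ∃ φ, IsPeriodicSolution (reduced (centered T γ) (gammaStar T γ)) T φ ∧
      ∫ t in (0 : ℝ)..T, φ t = 0 := by
  obtain ⟨lam, φ, hφ, hmean⟩ := exists_isPeriodicSolution_reduced_integral_eq_zero hT
    (continuous_centered hγ) (periodic_centered hγp)
  exact ⟨φ, gammaStar_eq hT hγ hφ hmean ▸ hφ, hmean⟩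

theorem isGreatest_and_isLeast_gammaStar (hT : 0 < T) (hγ : Continuous γ)
    (hγp : Function.Periodic γ T) :
    IsGreatest (muLower T γ '' C1T T) (gammaStar T γ) ∧
      IsLeast (muUpper T γ '' C1T0 T) (gammaStar T γ) := by
  obtain ⟨φ, hφ, hmean⟩ := exists_isPeriodicSolution_reduced_gammaStar hT hγ hγp
  exact ⟨isGreatest_muLower hT hγ hφ hmean, isLeast_muUpper hT hγ hφ hmean⟩

theorem IsPeriodicSolution.param_le_gammaStar (hT : 0 < T) (hγ : Continuous γ)
    (hγp : Function.Periodic γ T)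
    (hφ : IsPeriodicSolution (reduced (centered T γ) lam) T φ) : lam ≤ gammaStar T γ := by
  obtain ⟨ψ, hψ, hmean⟩ := exists_isPeriodicSolution_reduced_gammaStar hT hγ hγp
  exact (isGreatest_muLower hT hγ hψ hmean).2 ⟨φ, hφ.mem_C1T (continuous_centered hγ),
    muLower_eq_of_isPeriodicSolution hT.le hφ⟩

theorem exists_isPeriodicSolution_reduced_of_lt_gammaStar (hT : 0 < T) (hγ : Continuous γ)
    (hγp : Function.Periodic γ T) (hlt : lam < gammaStar T γ) :
    ∃ φ, IsPeriodicSolution (reduced (centered T γ) lam) T φ ∧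
      ∫ t in (0 : ℝ)..T, φ t ≠ 0 := by
  obtain ⟨ψ, hψ, -⟩ := exists_isPeriodicSolution_reduced_gammaStar hT hγ hγp
  obtain ⟨φ, hφ⟩ := exists_isPeriodicSolution_reduced_of_strict_upper (lam := lam) hT
    (continuous_centered hγ) (periodic_centered hγp) hψ.1.hasDerivAt hψ.2 fun t => by
      rw [reduced_apply]
      linarith
  exact ⟨φ, hφ, fun hmean => hlt.ne' (gammaStar_eq hT hγ hφ hmean)⟩

end Characterization

/-! ### Reduction of the general equation -/

section Reduction

variable {T : ℝ} {a₂ a₁ a₀ x y : ℝ → ℝ}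

theorem contDiff_shift (ha₂ : ContDiff ℝ 2 a₂) (ha₁ : ContDiff ℝ 1 a₁) (hne : ∀ t, a₂ t ≠ 0) :
    ContDiff ℝ 1 (shift a₂ a₁) :=
  contDiff_const.mul (ha₁.add ((ContDiff.deriv' ha₂).div (ha₂.of_le one_le_two) hne))

theorem continuous_reducedGamma (ha₂ : ContDiff ℝ 2 a₂) (ha₁ : ContDiff ℝ 1 a₁)
    (ha₀ : Continuous a₀) (hne : ∀ t, a₂ t ≠ 0) : Continuous (reducedGamma a₂ a₁ a₀) := by
  have hA := contDiff_shift ha₂ ha₁ hne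
  exact ((ha₂.continuous.mul ha₀).sub (hA.continuous.pow 2)).add (hA.continuous_deriv le_rfl)

theorem periodic_shift (hp₂ : Function.Periodic a₂ T) (hp₁ : Function.Periodic a₁ T) :
    Function.Periodic (shift a₂ a₁) T := fun t => by
  simp only [shift, hp₂ t, hp₁ t, periodic_deriv hp₂ t]

theorem periodic_reducedGamma (hp₂ : Function.Periodic a₂ T) (hp₁ : Function.Periodic a₁ T)
    (hp₀ : Function.Periodic a₀ T) : Function.Periodic (reducedGamma a₂ a₁ a₀) T := fun t => by
  simp only [reducedGamma, hp₂ t, hp₀ t, periodic_shift hp₂ hp₁ t,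
    periodic_deriv (periodic_shift hp₂ hp₁) t]

theorem reduced_centered_average (T : ℝ) (γ : ℝ → ℝ) :
    reduced (centered T γ) (average T γ) = reduced γ 0 := by
  funext t y
  rw [reduced_apply, reduced_apply, centered]
  ring

theorem eq_two_mul_shift_sub (a₂ a₁ : ℝ → ℝ) (t : ℝ) :
    a₁ t = 2 * shift a₂ a₁ t - deriv a₂ t / a₂ t := by
  rw [shift]
  ring

theorem IsPeriodicSolution.mul_add_shift (ha₂ : ContDiff ℝ 2 a₂) (ha₁ : ContDiff ℝ 1 a₁)
    (hp₂ : Function.Periodic a₂ T) (hp₁ : Function.Periodic a₁ T) (hne : ∀ t, a₂ t ≠ 0)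
    (hx : IsPeriodicSolution (riccati a₂ a₁ a₀) T x) :
    IsPeriodicSolution (reduced (reducedGamma a₂ a₁ a₀) 0) T
      fun t => a₂ t * x t + shift a₂ a₁ t := by
  refine ⟨fun t _ => ?_, fun t => by simp only [hp₂ t, hx.2 t, periodic_shift hp₂ hp₁ t]⟩
  have hda₂ := (ha₂.differentiable two_ne_zero t).hasDerivAt
  have hdA := ((contDiff_shift ha₂ ha₁ hne).differentiable one_ne_zero t).hasDerivAt
  refine (((hda₂.mul (hx.1.hasDerivAt t)).add hdA).congr_deriv ?_).hasDerivWithinAt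
  rw [reduced_apply, reducedGamma, riccati, eq_two_mul_shift_sub a₂ a₁ t]
  field_simp [hne t]
  ring

theorem IsPeriodicSolution.sub_shift_div (ha₂ : ContDiff ℝ 2 a₂) (ha₁ : ContDiff ℝ 1 a₁)
    (hp₂ : Function.Periodic a₂ T) (hp₁ : Function.Periodic a₁ T) (hne : ∀ t, a₂ t ≠ 0)
    (hy : IsPeriodicSolution (reduced (reducedGamma a₂ a₁ a₀) 0) T y) :
    IsPeriodicSolution (riccati a₂ a₁ a₀) T fun t => (y t - shift a₂ a₁ t) / a₂ t := by
  refine ⟨fun t _ => ?_, fun t => by simp only [hp₂ t, hy.2 t, periodic_shift hp₂ hp₁ t]⟩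
  have hda₂ := (ha₂.differentiable two_ne_zero t).hasDerivAt
  have hdA := ((contDiff_shift ha₂ ha₁ hne).differentiable one_ne_zero t).hasDerivAt
  refine ((((hy.1.hasDerivAt t).sub hdA).div hda₂ (hne t)).congr_deriv ?_).hasDerivWithinAt
  rw [reduced_apply, reducedGamma, riccati, eq_two_mul_shift_sub a₂ a₁ t, Pi.sub_apply]
  field_simp [hne t]
  ring

/-- Linearizing (R) turns `y` into `2 * y` up to the logarithmic derivative of `a₂`, which has
zero mean. -/
theorem variation_sub_shift_div_eq_one_iff (ha₂ : ContDiff ℝ 1 a₂)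
    (hp₂ : Function.Periodic a₂ T) (hne : ∀ t, a₂ t ≠ 0) (hy : Continuous y) :
    variation a₂ a₁ (fun t => (y t - shift a₂ a₁ t) / a₂ t) T = 1 ↔
      ∫ t in (0 : ℝ)..T, y t = 0 := by
  have hlog : Continuous fun t => deriv a₂ t / a₂ t :=
    (ha₂.continuous_deriv le_rfl).div ha₂.continuous hne
  have hfun : (fun t => 2 * a₂ t * ((y t - shift a₂ a₁ t) / a₂ t) + a₁ t) =
      fun t => 2 * y t - deriv a₂ t / a₂ t := funext fun t => by
    rw [eq_two_mul_shift_sub a₂ a₁ t]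
    field_simp [hne t]
    ring
  rw [variation, Real.exp_eq_one_iff, hfun, intervalIntegral.integral_sub
    ((hy.const_mul 2).intervalIntegrable _ _) (hlog.intervalIntegrable _ _),
    integral_logDeriv_eq_zero ha₂ hp₂ hne, sub_zero, intervalIntegral.integral_const_mul,
    mul_eq_zero, or_iff_right two_ne_zero]

end Reduction

section Discriminant

variable {T : ℝ} {a₂ a₁ a₀ : ℝ → ℝ}

theorem exists_two_hyperbolic_of_discriminant_pos (hT : 0 < T) (ha₂ : ContDiff ℝ 2 a₂)
    (ha₁ : ContDiff ℝ 1 a₁) (ha₀ : Continuous a₀) (hp₂ : Function.Periodic a₂ T)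
    (hp₁ : Function.Periodic a₁ T) (hp₀ : Function.Periodic a₀ T) (hne : ∀ t, a₂ t ≠ 0)
    (hpos : 0 < discriminant T (reducedGamma a₂ a₁ a₀)) :
    ∃ φ₁ φ₂ : ℝ → ℝ, φ₁ ≠ φ₂ ∧
      {φ | IsPeriodicSolution (riccati a₂ a₁ a₀) T φ} = {φ₁, φ₂} ∧
      IsHyperbolicLimitCycle (riccati a₂ a₁ a₀) T φ₁ ∧
      IsHyperbolicLimitCycle (riccati a₂ a₁ a₀) T φ₂ := by
  obtain ⟨y, hy, hmean⟩ := exists_isPeriodicSolution_reduced_of_lt_gammaStar hT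
    (continuous_reducedGamma ha₂ ha₁ ha₀ hne) (periodic_reducedGamma hp₂ hp₁ hp₀)
    (sub_pos.1 hpos)
  rw [reduced_centered_average] at hy
  exact ⟨_, exists_two_hyperbolic_of_variation_ne_one ha₂.continuous ha₁.continuous ha₀ hp₂ hp₁
    hp₀ hne hT (hy.sub_shift_div ha₂ ha₁ hp₂ hp₁ hne)
    ((variation_sub_shift_div_eq_one_iff (ha₂.of_le one_le_two) hp₂ hne
      hy.1.continuous).not.2 hmean)⟩

theorem exists_semiStable_double_of_discriminant_eq_zero (hT : 0 < T) (ha₂ : ContDiff ℝ 2 a₂)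
    (ha₁ : ContDiff ℝ 1 a₁) (ha₀ : Continuous a₀) (hp₂ : Function.Periodic a₂ T)
    (hp₁ : Function.Periodic a₁ T) (hp₀ : Function.Periodic a₀ T) (hne : ∀ t, a₂ t ≠ 0)
    (hzero : discriminant T (reducedGamma a₂ a₁ a₀) = 0) :
    ∃ φ : ℝ → ℝ, {ψ | IsPeriodicSolution (riccati a₂ a₁ a₀) T ψ} = {φ} ∧
      IsDoubleLimitCycle (riccati a₂ a₁ a₀) T φ ∧ IsSemiStable (riccati a₂ a₁ a₀) φ := by
  obtain ⟨y, hy, hmean⟩ := exists_isPeriodicSolution_reduced_gammaStar hT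
    (continuous_reducedGamma ha₂ ha₁ ha₀ hne) (periodic_reducedGamma hp₂ hp₁ hp₀)
  rw [sub_eq_zero.1 hzero, reduced_centered_average] at hy
  have hx := hy.sub_shift_div ha₂ ha₁ hp₂ hp₁ hne
  have hm := (variation_sub_shift_div_eq_one_iff (a₁ := a₁) (ha₂.of_le one_le_two) hp₂ hne
    hy.1.continuous).2 hmean
  have h₂ := ha₂.continuous
  have h₁ := ha₁.continuous
  exact ⟨_, setOf_isPeriodicSolution_eq_singleton h₂ h₁ hne hT hx hm,
    isDoubleLimitCycle_of_variation_eq_one h₂ h₁ hne hT hx hm,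
    isSemiStable_of_variation_eq_one h₂ h₁ hp₂ hp₁ hne hT.ne' hx hm⟩

theorem setOf_isPeriodicSolution_eq_empty_of_discriminant_neg (hT : 0 < T)
    (ha₂ : ContDiff ℝ 2 a₂) (ha₁ : ContDiff ℝ 1 a₁) (ha₀ : Continuous a₀)
    (hp₂ : Function.Periodic a₂ T) (hp₁ : Function.Periodic a₁ T) (hp₀ : Function.Periodic a₀ T)
    (hne : ∀ t, a₂ t ≠ 0) (hneg : discriminant T (reducedGamma a₂ a₁ a₀) < 0) :
    {φ | IsPeriodicSolution (riccati a₂ a₁ a₀) T φ} = ∅ := by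
  refine eq_empty_of_forall_notMem fun x hx => (sub_neg.1 hneg).not_ge ?_
  have hy := hx.mul_add_shift ha₂ ha₁ hp₂ hp₁ hne
  rw [← reduced_centered_average T] at hy
  exact hy.param_le_gammaStar hT (continuous_reducedGamma ha₂ ha₁ ha₀ hne)
    (periodic_reducedGamma hp₂ hp₁ hp₀)

end Discriminant

end PeriodicRiccati

end

open PeriodicRiccati Set in
theorem mainTheorem4_general (T : ℝ) (hT : 0 < T) (a₂ a₁ a₀ : ℝ → ℝ)
    (ha₂ : ContDiff ℝ 2 a₂) (ha₁ : ContDiff ℝ 1 a₁) (ha₀ : Continuous a₀)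
    (hp₂ : Function.Periodic a₂ T) (hp₁ : Function.Periodic a₁ T)
    (hp₀ : Function.Periodic a₀ T) (hne : ∀ t, a₂ t ≠ 0)
    (γ : ℝ → ℝ) (hγ : γ = reducedGamma a₂ a₁ a₀)
    (f : ℝ → ℝ → ℝ) (hf : f = riccati a₂ a₁ a₀) :
    (IsGreatest (muLower T γ '' C1T T) (gammaStar T γ) ∧
      IsLeast (muUpper T γ '' C1T0 T) (gammaStar T γ)) ∧
    (0 < discriminant T γ →
      ∃ φ₁ φ₂ : ℝ → ℝ, φ₁ ≠ φ₂ ∧ {φ | IsPeriodicSolution f T φ} = {φ₁, φ₂} ∧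
        IsHyperbolicLimitCycle f T φ₁ ∧ IsHyperbolicLimitCycle f T φ₂) ∧
    (discriminant T γ = 0 →
      ∃ φ : ℝ → ℝ, {ψ | IsPeriodicSolution f T ψ} = {φ} ∧
        IsDoubleLimitCycle f T φ ∧ IsSemiStable f φ) ∧
    (discriminant T γ < 0 → {φ | IsPeriodicSolution f T φ} = ∅) ∧
    (∀ p ∈ C1T T, ∀ q ∈ C1T0 T,
      muLower T γ p - average T γ ≤ discriminant T γ ∧
        discriminant T γ ≤ muUpper T γ q - average T γ) := by
  subst hγ hf
  have hγc := continuous_reducedGamma ha₂ ha₁ ha₀ hne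
  have hγp := periodic_reducedGamma hp₂ hp₁ hp₀
  obtain ⟨hgreatest, hleast⟩ := isGreatest_and_isLeast_gammaStar hT hγc hγp
  exact ⟨⟨hgreatest, hleast⟩,
    exists_two_hyperbolic_of_discriminant_pos hT ha₂ ha₁ ha₀ hp₂ hp₁ hp₀ hne,
    exists_semiStable_double_of_discriminant_eq_zero hT ha₂ ha₁ ha₀ hp₂ hp₁ hp₀ hne,
    setOf_isPeriodicSolution_eq_empty_of_discriminant_neg hT ha₂ ha₁ ha₀ hp₂ hp₁ hp₀ hne,
    fun _ hp _ hq => ⟨sub_le_sub_right (hgreatest.2 (mem_image_of_mem _ hp)) _,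
      sub_le_sub_right (hleast.2 (mem_image_of_mem _ hq)) _⟩⟩

theorem mainTheorem4 (T : ℝ) (hT : 0 < T) (a₂ a₁ a₀ : ℝ → ℝ)
    (ha₂ : ContDiff ℝ ∞ a₂) (ha₁ : ContDiff ℝ ∞ a₁) (ha₀ : ContDiff ℝ ∞ a₀)
    (hp₂ : Function.Periodic a₂ T) (hp₁ : Function.Periodic a₁ T)
    (hp₀ : Function.Periodic a₀ T) (hne : ∀ t, a₂ t ≠ 0)
    (γ : ℝ → ℝ) (hγ : γ = PeriodicRiccati.reducedGamma a₂ a₁ a₀)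
    (f : ℝ → ℝ → ℝ) (hf : f = PeriodicRiccati.riccati a₂ a₁ a₀) :
    -- the number entering the discriminant is a maximum, and also a minimum
    (IsGreatest (PeriodicRiccati.muLower T γ '' PeriodicRiccati.C1T T)
        (PeriodicRiccati.gammaStar T γ) ∧
      IsLeast (PeriodicRiccati.muUpper T γ '' PeriodicRiccati.C1T0 T)
        (PeriodicRiccati.gammaStar T γ)) ∧
    -- positive discriminant: exactly two periodic solutions, both hyperbolic limit cycles
    (0 < PeriodicRiccati.discriminant T γ →
      ∃ φ₁ φ₂ : ℝ → ℝ, φ₁ ≠ φ₂ ∧ {φ | PeriodicRiccati.IsPeriodicSolution f T φ} = {φ₁, φ₂} ∧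
        PeriodicRiccati.IsHyperbolicLimitCycle f T φ₁ ∧
        PeriodicRiccati.IsHyperbolicLimitCycle f T φ₂) ∧
    -- zero discriminant: exactly one periodic solution, a semi-stable double limit cycle
    (PeriodicRiccati.discriminant T γ = 0 →
      ∃ φ : ℝ → ℝ, {ψ | PeriodicRiccati.IsPeriodicSolution f T ψ} = {φ} ∧
        PeriodicRiccati.IsDoubleLimitCycle f T φ ∧ PeriodicRiccati.IsSemiStable f φ) ∧
    -- negative discriminant: no periodic solution
    (PeriodicRiccati.discriminant T γ < 0 →
      {φ | PeriodicRiccati.IsPeriodicSolution f T φ} = ∅) ∧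
    -- bounds for the discriminant
    (∀ p ∈ PeriodicRiccati.C1T T, ∀ q ∈ PeriodicRiccati.C1T0 T,
      PeriodicRiccati.muLower T γ p - PeriodicRiccati.average T γ
          ≤ PeriodicRiccati.discriminant T γ ∧
        PeriodicRiccati.discriminant T γ
          ≤ PeriodicRiccati.muUpper T γ q - PeriodicRiccati.average T γ) :=
  mainTheorem4_general T hT a₂ a₁ a₀ (contDiff_infty.1 ha₂ 2) (contDiff_infty.1 ha₁ 1)
    ha₀.continuous hp₂ hp₁ hp₀ hne γ hγ f hf
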